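/- \textbf{Setting.} Consider the convex quadratic program $$F^*=\min\{F(u)=\tfrac12u^TQu+q^Tu:\ u\in U,\ Gu+g\in\mathcal K\},$$ where $Q\in\mathbb R^{n\times n}$ is symmetric positive semidefinite, $G\in\mathbb R^{p\times n}$, $U\subset\mathbb R^n$ is compact and convex (e.g. a box) with diameter $D_U$, and $\mathcal K=\{0\}$ or $\mathcal K=\mathbb R^p_-$. Norms are Euclidean (spectral for matrices). Assume that the problem is feasible and has an optimal Lagrange multiplier, i.e. some $\lambda\in\mathbb R^p$ with $F(u)+\langle\lambda,Gu+g-s\rangle\ge F^*$ for all $u\in U$, $s\in\mathcal K$. For $\rho>0$ let $$\mathcal L_\rho(u,\lambda)=\min_{s\in\mathcal K}F(u)+\langle\lambda,Gu+g-s\rangle+\tfrac\rho2\|Gu+g-s\|^2,\qquad d_\rho(\lambda)=\min_{u\in U}\mathcal L_\rho(u,\lambda),$$ where the first minimum is attained at $s(u,\lambda)=[Gu+g+\lambda/\rho]_{\mathcal K}$. Here $[\cdot]_X$ is the projection on $X$. Let $\mathcal K_d=\mathbb R^p_+$ if $Q\succ0$ and $\mathcal K=\mathbb R^p_-$, and $\mathcal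 K_d=\mathbb R^p$ otherwise; let $\Lambda^*$ be the set of maximizers of $d_\rho$ on $\mathcal K_d$ and $R_d=\mathrm{dist}(0,\Lambda^*)$. Put $$L_d=\frac{\|G\|^2}{\lambda_{\min}(Q)+\rho\|G\|^2},\qquad L_{\mathcal L}=\lambda_{\max}(Q)+\rho\|G\|^2,$$ and $\sigma_{\mathcal L}=\lambda_{\min}(Q+\rho G^TG)$ if $\mathcal K=\{0\}$, $\sigma_{\mathcal L}=\lambda_{\min}(Q)$ if $\mathcal K=\mathbb R^p_-$. \textbf{Algorithms.} Let $\vartheta_0=0$ and $\vartheta_{k+1}=\frac12\bigl(1+\sqrt{1+4\vartheta_k^2}\bigr)$, so that $\vartheta_1=1$. \emph{Inner method} FOM$(\mathcal L_\rho(\cdot,\mu),U)$: from $x^0=y^1\in U$, for $k\ge1$, $$x^k=\bigl[y^k-\tfrac1{L_{\mathcal L}}\nabla_u\mathcal L_\rho(y^k,\mu)\bigr]_U,\qquad y^{k+1}=x^k+\beta_k(x^k-x^{k-1}),$$ with $\beta_k=(\vartheta_k-1)/\vartheta_{k+1}$ if $\sigma_{\mathcal L}=0$ and $\beta_k=\frac{\sqrt{L_{\mathcal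 L}}-\sqrt{\sigma_{\mathcal L}}}{\sqrt{L_{\mathcal L}}+\sqrt{\sigma_{\mathcal L}}}$ if $\sigma_{\mathcal L}>0$. Each iteration is charged one projection on $U$, one product with $Q$ and one with $G^T$. \emph{Outer method} DFOM, in either of two schemes, DGM ($\theta_k=1$) or DFGM ($\theta_k=\vartheta_k$): from $\bar u^0\in U$ arbitrary and $\lambda^0=\mu^1=0$, for $k\ge1$, let $\bar u^k$ be the result of $m\ge1$ iterations of FOM$(\mathcal L_\rho(\cdot,\mu^k),U)$ started at $\bar u^{k-1}$, and $$\lambda^k=\bigl[\mu^k+\tfrac1{2L_d}(G\bar u^k+g-s(\bar u^k,\mu^k))\bigr]_{\mathcal K_d},\qquad \mu^{k+1}=\lambda^k+\tfrac{\theta_k-1}{\theta_{k+1}}(\lambda^k-\lambda^{k-1}).$$ The average iterate is $\hat u^k=\sum_{j=1}^k\theta_j\bar u^j\big/\sum_{j=1}^k\theta_j$. The last iterate $\bar u(\lambda^k)$ is the result of $m$ further iterations of FOM$(\mathcal L_\rho(\cdot,\lambda^k),U)$ started at $\bar u^k$. Let $\epsilon_{\rm in}=\frac\epsilon4$, $k_{\rm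 out}=\bigl\lceil\frac{8L_dR_d^2}\epsilon\bigr\rceil$ for DGM, and $\epsilon_{\rm in}=\frac{\epsilon\sqrt\epsilon}{8R_d\sqrt{2L_d}}$, $k_{\rm out}=\Bigl\lceil\sqrt{\frac{8L_dR_d^2}\epsilon}\Bigr\rceil$ for DFGM. Let $$k_{\rm total}=\begin{cases}\left\lfloor\dfrac{24\|G\|D_UR_d}{\epsilon}\right\rfloor&\text{if }\sigma_{\mathcal L}=0,\\[2mm]\left\lfloor\dfrac{16\|G\|R_d}{\sqrt{\sigma_{\mathcal L}\epsilon}}\log\dfrac{8\|G\|D_UR_d}{\epsilon}\right\rfloor&\text{if }\sigma_{\mathcal L}>0,\end{cases}$$ read as $0$ if the expression is negative or $D_U=0$. \textbf{Theorem.} There is an absolute constant $C>0$ such that the following holds for all such problems and both schemes. Let $0<\epsilon<1$, $\rho=8R_d^2/\epsilon$, $R_d>1$ and $\lambda_{\max}(Q)\le\|G\|^2R_d^2/\epsilon$ (which holds in particular if $\lambda_{\max}(Q)\le\|G\|^2$). (a) \emph{Average iterate} ($N=k_{\rm out}$ inner problems). For every $m\ge\max\{1,\lfloor k_{\rm total}/N\rfloor\}$,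 each inner problem is solved to accuracy $\epsilon_{\rm in}$, i.e. $0\le\mathcal L_\rho(\bar u^j,\mu^j)-d_\rho(\mu^j)\le\epsilon_{\rm in}$ for $1\le j\le k_{\rm out}$, and $u=\hat u^{k_{\rm out}}$ is $\epsilon$-primal optimal: $u\in U$, $\mathrm{dist}_{\mathcal K}(Gu+g)\le C\epsilon$ and $|F(u)-F^*|\le C\epsilon$. (b) \emph{Last iterate} ($N=k_{\rm out}+1$ inner problems). For every $m\ge\max\{1,\lfloor k_{\rm total}/N\rfloor\}$, each inner problem, including the one at $\lambda^{k_{\rm out}}$, is solved to accuracy $\epsilon_{\rm in}$, and $u=\bar u(\lambda^{k_{\rm out}})$ is $\sqrt\epsilon$-primal optimal: $u\in U$, $\mathrm{dist}_{\mathcal K}(Gu+g)\le C\sqrt\epsilon$ and $|F(u)-F^*|\le C\sqrt\epsilon$. In both cases, for the smallest such $m$, the total number of projections on $U$, of products with $Q$ and of products with $G^T$ is each at most $\max\{k_{\rm total},N\}$, hence at most $k_{\rm total}$ as soon as $k_{\rm total}\ge N$. -/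

import Mathlib

noncomputable section

namespace DuQuad

/-- `ℝⁿ` with the Euclidean norm. -/
abbrev E (n : ℕ) := EuclideanSpace ℝ (Fin n)

/-- The matrix `A`, acting on column vectors, as a continuous linear map of Euclidean spaces.
Its operator norm is the spectral norm of `A`. -/
def act {m n : ℕ} (A : Matrix (Fin m) (Fin n) ℝ) : E n →L[ℝ] E m :=
  (Matrix.toEuclideanLin A).toContinuousLinearMap

/-- `v` is a point of `X` nearest to `x`. -/
def IsNearest {V : Type*} [NormedAddCommGroup V] (X : Set V) (x v : V) : Prop :=
  v ∈ X ∧ ∀ w ∈ X, ‖x - v‖ ≤ ‖x - w‖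

open Classical in
/-- The projection `[x]_X` (used only for nonempty closed convex `X` in a Euclidean space, where
the nearest point exists and is unique). -/
def proj {V : Type*} [NormedAddCommGroup V] (X : Set V) (x : V) : V :=
  if h : ∃ v, IsNearest X x v then h.choose else x

theorem proj_isNearest {V : Type*} [NormedAddCommGroup V] [InnerProductSpace ℝ V] [CompleteSpace V]
    {X : Set V} (hne : X.Nonempty) (hcl : IsClosed X) (hcv : Convex ℝ X) (x : V) :
    IsNearest X x (proj X x) := by
  have h : ∃ v, IsNearest X x v := by
    obtain ⟨v, hv, he⟩ := exists_norm_eq_iInf_of_complete_convex hne hcl.isComplete hcv x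
    refine ⟨v, hv, fun w hw => ?_⟩
    rw [he]
    exact ciInf_le ⟨0, by rintro _ ⟨w, rfl⟩; positivity⟩ (⟨w, hw⟩ : X)
  unfold proj
  rw [dif_pos h]
  exact h.choose_spec

theorem proj_inner_le {V : Type*} [NormedAddCommGroup V] [InnerProductSpace ℝ V] [CompleteSpace V]
    {X : Set V} (hne : X.Nonempty) (hcl : IsClosed X) (hcv : Convex ℝ X) (x w : V) (hw : w ∈ X) :
    inner ℝ (x - proj X x) (w - proj X x) ≤ 0 := by
  obtain ⟨hm, hmin⟩ := proj_isNearest hne hcl hcv x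
  refine (norm_eq_iInf_iff_real_inner_le_zero hcv hm).1 ?_ w hw
  have : Nonempty X := ⟨⟨_, hm⟩⟩
  apply le_antisymm
  · exact le_ciInf fun w => hmin w w.2
  · exact ciInf_le ⟨0, by rintro _ ⟨w, rfl⟩; positivity⟩ (⟨_, hm⟩ : X)

/-- The two kinds of complicating constraints: `𝒦 = {0}` and `𝒦 = ℝ^p_-`. -/
inductive ConeKind
  | zero
  | nonpos

/-- The cone `𝒦`. -/
def ConeKind.cone : ConeKind → (p : ℕ) → Set (E p)
  | .zero, _ => {0}
  | .nonpos, _ => {y | ∀ i, y i ≤ 0}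

/-- Data of the convex quadratic problem
`min ½ uᵀQu + qᵀu` subject to `u ∈ U`, `G u + g ∈ 𝒦`. -/
structure QP (n p : ℕ) where
  Q : Matrix (Fin n) (Fin n) ℝ
  q : E n
  G : Matrix (Fin p) (Fin n) ℝ
  g : E p
  U : Set (E n)
  kind : ConeKind
  posSemidef : Q.PosSemidef
  convex_U : Convex ℝ U
  compact_U : IsCompact U

/-- Smallest eigenvalue of a symmetric matrix. -/
def lamMin {n : ℕ} (A : Matrix (Fin n) (Fin n) ℝ) : ℝ := sInf (spectrum ℝ A)

/-- Largest eigenvalue of a symmetric matrix. -/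
def lamMax {n : ℕ} (A : Matrix (Fin n) (Fin n) ℝ) : ℝ := sSup (spectrum ℝ A)

namespace QP

variable {n p : ℕ} (P : QP n p)

/-- The cone `𝒦` of the problem. -/
def K : Set (E p) := P.kind.cone p

/-- The spectral norm `‖G‖`. -/
def normG : ℝ := ‖act P.G‖

/-- The diameter `D_U`. -/
def DU : ℝ := Metric.diam P.U

/-- The objective `F(u) = ½ uᵀQu + qᵀu`. -/
def F (u : E n) : ℝ := (1 / 2) * inner ℝ u (act P.Q u) + inner ℝ P.q u

/-- The constraint map `u ↦ G u + g`. -/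
def con (u : E n) : E p := act P.G u + P.g

/-- The feasible set `{u ∈ U : G u + g ∈ 𝒦}`. -/
def feasible : Set (E n) := {u | u ∈ P.U ∧ P.con u ∈ P.K}

/-- The optimal value `F^*`. -/
def Fstar : ℝ := sInf (P.F '' P.feasible)

/-- `lam` is an optimal Lagrange multiplier of the (feasible) problem: minimizing the Lagrangian
over `u ∈ U`, `s ∈ 𝒦` gives at least `F^*`. -/
def IsLagrangeMultiplier (lam : E p) : Prop :=
  P.feasible.Nonempty ∧
    ∀ u ∈ P.U, ∀ s ∈ P.K, P.Fstar ≤ P.F u + inner ℝ lam (P.con u - s)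

/-- The augmented Lagrangian
`𝓛_ρ(u, λ) = min_{s ∈ 𝒦} F(u) + ⟨λ, Gu + g - s⟩ + (ρ/2) ‖Gu + g - s‖²`. -/
def lag (ρ : ℝ) (u : E n) (lam : E p) : ℝ :=
  ⨅ s : P.K, (P.F u + inner ℝ lam (P.con u - s) + ρ / 2 * ‖P.con u - s‖ ^ 2)

/-- The minimizer `s(u, λ)` in the definition of `𝓛_ρ(u, λ)`, namely `[Gu + g + λ/ρ]_𝒦` if
`ρ > 0`, and `0` if `ρ = 0`. -/
def sOpt (ρ : ℝ) (u : E n) (lam : E p) : E p :=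
  if 0 < ρ then proj P.K (P.con u + (1 / ρ) • lam) else 0

/-- The dual function `d_ρ(λ) = min_{u ∈ U} 𝓛_ρ(u, λ)`. -/
def dual (ρ : ℝ) (lam : E p) : ℝ := sInf ((fun u => P.lag ρ u lam) '' P.U)

open Classical in
/-- The set `𝒦_d` of the dual problem: `ℝ^p_+` if `Q ≻ 0` and `𝒦 = ℝ^p_-`, otherwise `ℝ^p`. -/
def Kd : Set (E p) :=
  if P.Q.PosDef ∧ P.kind = ConeKind.nonpos then {y | ∀ i, 0 ≤ y i} else Set.univ

/-- The set `Λ^*` of optimal solutions of `max_{λ ∈ 𝒦_d} d_ρ(λ)`. -/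
def dualOpt (ρ : ℝ) : Set (E p) := {lam | lam ∈ P.Kd ∧ ∀ nu ∈ P.Kd, P.dual ρ nu ≤ P.dual ρ lam}

/-- `R_d`, the distance from the starting multiplier `λ⁰ = 0` to `Λ^*`. -/
def Rd (ρ : ℝ) : ℝ := Metric.infDist 0 (P.dualOpt ρ)

/-- `L_d = ‖G‖² / (λ_min(Q) + ρ‖G‖²)`. -/
def Ld (ρ : ℝ) : ℝ := P.normG ^ 2 / (lamMin P.Q + ρ * P.normG ^ 2)

/-- `L_𝓛 = λ_max(Q) + ρ‖G‖²`, a Lipschitz constant of `∇_u 𝓛_ρ(·, λ)`. -/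
def LL (ρ : ℝ) : ℝ := lamMax P.Q + ρ * P.normG ^ 2

/-- The strong convexity constant `σ_𝓛` of the functions `𝓛_ρ(·, λ)`, uniform in `λ`:
`λ_min(Q + ρGᵀG)` for `𝒦 = {0}`, and `λ_min(Q)` for `𝒦 = ℝ^p_-` (where `𝓛_ρ(·, λ)` has Hessian
`Q` at the points at which all the constraints are inactive). -/
def sigmaL (ρ : ℝ) : ℝ :=
  match P.kind with
  | .zero => lamMin (P.Q + ρ • (P.G.transpose * P.G))
  | .nonpos => lamMin P.Q

/-- `∇_u 𝓛_ρ(u, λ) = Qu + q + Gᵀ(λ + ρ(Gu + g - s(u, λ)))`, see `hasGradientAt_lag`. -/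
def gradLag (ρ : ℝ) (lam : E p) (u : E n) : E n :=
  act P.Q u + P.q + act P.G.transpose (lam + ρ • (P.con u - P.sOpt ρ u lam))

theorem K_nonempty : P.K.Nonempty := by
  unfold K
  cases P.kind
  · exact ⟨0, rfl⟩
  · exact ⟨0, fun i => le_refl _⟩

theorem K_closed : IsClosed P.K := by
  unfold K
  cases P.kind
  · exact isClosed_singleton
  · simp only [ConeKind.cone, Set.ofPred_forall]
    exact isClosed_iInter fun i => isClosed_le (by fun_prop) continuous_const

theorem K_convex : Convex ℝ P.K := by
  unfold K
  cases P.kind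
  · exact convex_singleton 0
  · intro x hx y hy a b ha hb _ i
    have h1 := mul_nonpos_of_nonneg_of_nonpos ha (hx i)
    have h2 := mul_nonpos_of_nonneg_of_nonpos hb (hy i)
    simpa using add_nonpos h1 h2

theorem lag_aux {ρ : ℝ} (hρ : 0 < ρ) (r lam : E p) :
    inner ℝ lam r + ρ / 2 * ‖r‖ ^ 2
      = ρ / 2 * ‖r + (1 / ρ) • lam‖ ^ 2 - ‖lam‖ ^ 2 / (2 * ρ) := by
  rw [norm_add_sq_real, norm_smul, inner_smul_right, real_inner_comm]
  simp only [Real.norm_eq_abs, abs_of_pos (one_div_pos.2 hρ)]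
  field_simp
  ring

/-- `s(u, λ)` attains the minimum that defines `𝓛_ρ(u, λ)`. -/
theorem lag_eq {ρ : ℝ} (hρ : 0 < ρ) (u : E n) (lam : E p) :
    P.lag ρ u lam = P.F u + inner ℝ lam (P.con u - P.sOpt ρ u lam)
      + ρ / 2 * ‖P.con u - P.sOpt ρ u lam‖ ^ 2 := by
  have hs : P.sOpt ρ u lam = proj P.K (P.con u + (1 / ρ) • lam) := by
    unfold sOpt; rw [if_pos hρ]
  obtain ⟨hm, hmin⟩ := proj_isNearest P.K_nonempty P.K_closed P.K_convex
    (P.con u + (1 / ρ) • lam)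
  rw [← hs] at hm hmin
  have key : ∀ s ∈ P.K, P.F u + inner ℝ lam (P.con u - P.sOpt ρ u lam)
      + ρ / 2 * ‖P.con u - P.sOpt ρ u lam‖ ^ 2
      ≤ P.F u + inner ℝ lam (P.con u - s) + ρ / 2 * ‖P.con u - s‖ ^ 2 := by
    intro s hsK
    have h1 := lag_aux hρ (P.con u - P.sOpt ρ u lam) lam
    have h2 := lag_aux hρ (P.con u - s) lam
    have h3 := hmin s hsK
    rw [add_sub_right_comm, add_sub_right_comm] at h3
    have h4 := pow_le_pow_left₀ (norm_nonneg _) h3 2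
    have h5 := mul_le_mul_of_nonneg_left h4 (by positivity : 0 ≤ ρ / 2)
    linarith
  have : Nonempty P.K := ⟨⟨_, hm⟩⟩
  unfold lag
  apply le_antisymm
  · exact ciInf_le ⟨_, by rintro _ ⟨s, rfl⟩; exact key s s.2⟩ (⟨_, hm⟩ : P.K)
  · exact le_ciInf fun s => key s s.2

theorem act_symm {A : Matrix (Fin n) (Fin n) ℝ} (hA : A.PosSemidef) (u v : E n) :
    inner ℝ u (act A v) = inner ℝ (act A u) v := by
  have := (Matrix.isSymmetric_toEuclideanLin_iff.2 hA.isHermitian) u v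
  exact this.symm

theorem act_nonneg {A : Matrix (Fin n) (Fin n) ℝ} (hA : A.PosSemidef) (u : E n) :
    0 ≤ inner ℝ u (act A u) := by
  have h := (Matrix.isPositive_toEuclideanLin_iff.2 hA).re_inner_nonneg_right u
  simpa [act] using h

theorem act_transpose (A : Matrix (Fin p) (Fin n) ℝ) (y : E p) (u : E n) :
    inner ℝ (act A.transpose y) u = inner ℝ y (act A u) := by
  simp only [act, LinearMap.coe_toContinuousLinearMap', PiLp.inner_apply, RCLike.inner_apply,
    conj_trivial, Matrix.toLpLin_apply, Matrix.mulVec, dotProduct, Matrix.transpose_apply,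
    Finset.mul_sum, Finset.sum_mul]
  rw [Finset.sum_comm]
  exact Finset.sum_congr rfl fun i _ => Finset.sum_congr rfl fun j _ => by ring

/-- `gradLag` is the gradient of the augmented Lagrangian in `u`. -/
theorem hasGradientAt_lag {ρ : ℝ} (hρ : 0 < ρ) (lam : E p) (u : E n) :
    HasGradientAt (fun v => P.lag ρ v lam) (P.gradLag ρ lam u) u := by
  set c : ℝ := ‖act P.Q‖ / 2 + ρ / 2 * ‖act P.G‖ ^ 2 with hc
  have hs : ∀ v, P.sOpt ρ v lam = proj P.K (P.con v + (1 / ρ) • lam) := by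
    intro v; unfold sOpt; rw [if_pos hρ]
  have bound : ∀ v, |P.lag ρ v lam - P.lag ρ u lam - inner ℝ (P.gradLag ρ lam u) (v - u)|
      ≤ c * ‖v - u‖ ^ 2 := by
    intro v
    set d := v - u with hd
    have hv : v = u + d := by simp [hd]
    set a := P.con v - P.sOpt ρ v lam + (1 / ρ) • lam with ha
    set b := P.con u - P.sOpt ρ u lam + (1 / ρ) • lam with hb
    have hcon : P.con v = P.con u + act P.G d := by
      simp only [con, hv, map_add]; abel
    have hF : P.F v = P.F u + inner ℝ (act P.Q u + P.q) d + (1 / 2) * inner ℝ d (act P.Q d) := by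
      have e1 := act_symm P.posSemidef u d
      have e2 := real_inner_comm d (act P.Q u)
      simp only [F, hv, map_add, inner_add_left, inner_add_right]
      linarith
    have hlv : P.lag ρ v lam = P.F v + ρ / 2 * ‖a‖ ^ 2 - ‖lam‖ ^ 2 / (2 * ρ) := by
      rw [P.lag_eq hρ, add_assoc, lag_aux hρ]; ring
    have hlu : P.lag ρ u lam = P.F u + ρ / 2 * ‖b‖ ^ 2 - ‖lam‖ ^ 2 / (2 * ρ) := by
      rw [P.lag_eq hρ, add_assoc, lag_aux hρ]; ring
    have hg : inner ℝ (P.gradLag ρ lam u) d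
        = inner ℝ (act P.Q u + P.q) d + ρ * inner ℝ b (act P.G d) := by
      have : lam + ρ • (P.con u - P.sOpt ρ u lam) = ρ • b := by
        rw [hb, smul_add, smul_smul, mul_one_div_cancel hρ.ne', one_smul, add_comm]
      rw [gradLag, inner_add_left, act_transpose, this, inner_smul_left]
      simp
    have hQ0 := act_nonneg P.posSemidef d
    have hQ1 : inner ℝ d (act P.Q d) ≤ ‖act P.Q‖ * ‖d‖ ^ 2 := by
      have h1 := real_inner_le_norm d (act P.Q d)
      have h2 := mul_le_mul_of_nonneg_left ((act P.Q).le_opNorm d) (norm_nonneg d)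
      nlinarith
    have hG1 : ‖act P.G d‖ ^ 2 ≤ ‖act P.G‖ ^ 2 * ‖d‖ ^ 2 := by
      rw [← mul_pow]
      exact pow_le_pow_left₀ (norm_nonneg _) ((act P.G).le_opNorm d) 2
    -- lower bound
    have hlow : ‖b‖ ^ 2 + 2 * inner ℝ b (act P.G d) ≤ ‖a‖ ^ 2 := by
      have hvi := proj_inner_le P.K_nonempty P.K_closed P.K_convex (P.con u + (1 / ρ) • lam)
        (P.sOpt ρ v lam) (by
          rw [hs]; exact (proj_isNearest P.K_nonempty P.K_closed P.K_convex _).1)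
      rw [← hs, add_sub_right_comm, ← hb] at hvi
      have hab : a = b + (act P.G d - (P.sOpt ρ v lam - P.sOpt ρ u lam)) := by
        rw [ha, hb, hcon]; abel
      rw [hab, norm_add_sq_real b, inner_sub_right]
      nlinarith [sq_nonneg ‖act P.G d - (P.sOpt ρ v lam - P.sOpt ρ u lam)‖]
    -- upper bound
    have hup : ‖a‖ ^ 2 ≤ ‖b‖ ^ 2 + 2 * inner ℝ b (act P.G d) + ‖act P.G d‖ ^ 2 := by
      have hmin := (proj_isNearest P.K_nonempty P.K_closed P.K_convex
        (P.con v + (1 / ρ) • lam)).2 (P.sOpt ρ u lam) (by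
          rw [hs]; exact (proj_isNearest P.K_nonempty P.K_closed P.K_convex _).1)
      rw [← hs, add_sub_right_comm, ← ha] at hmin
      have hab : P.con v + (1 / ρ) • lam - P.sOpt ρ u lam = b + act P.G d := by
        rw [hb, hcon]; abel
      rw [hab] at hmin
      have := pow_le_pow_left₀ (norm_nonneg _) hmin 2
      rwa [norm_add_sq_real b] at this
    rw [hlv, hlu, hg, hF, abs_le]
    have m1 := mul_le_mul_of_nonneg_left hlow (by positivity : 0 ≤ ρ / 2)
    have m2 := mul_le_mul_of_nonneg_left hup (by positivity : 0 ≤ ρ / 2)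
    have m3 := mul_le_mul_of_nonneg_left hG1 (by positivity : 0 ≤ ρ / 2)
    have m4 : 0 ≤ c * ‖d‖ ^ 2 := by positivity
    have m5 : c * ‖d‖ ^ 2 = ‖act P.Q‖ / 2 * ‖d‖ ^ 2 + ρ / 2 * (‖act P.G‖ ^ 2 * ‖d‖ ^ 2) := by
      rw [hc]; ring
    constructor <;> linarith
  rw [hasGradientAt_iff_isLittleO]
  have h2 : (fun v => ‖v - u‖ ^ 2) =o[nhds u] fun v => v - u := by
    have h := (Asymptotics.isLittleO_norm_pow_id (E' := E n) one_lt_two)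
    have ht : Filter.Tendsto (fun v : E n => v - u) (nhds u) (nhds 0) := by
      have : Filter.Tendsto (fun v : E n => v - u) (nhds u) (nhds (u - u)) :=
        (continuous_id.sub continuous_const).tendsto u
      simpa using this
    exact h.comp_tendsto ht
  refine Asymptotics.IsBigO.trans_isLittleO (Asymptotics.IsBigO.of_bound c ?_) h2
  filter_upwards with v
  rw [Real.norm_eq_abs, Real.norm_eq_abs, abs_of_nonneg (by positivity : 0 ≤ ‖v - u‖ ^ 2)]
  exact bound v

/-- The inexact dual gradient `G ū + g - s(ū, μ)`. -/
def dualGrad (ρ : ℝ) (u : E n) (mu : E p) : E p := P.con u - P.sOpt ρ u mu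

/-- `u` is a `δ`-primal solution with constant `C`: `u ∈ U`, `dist_𝒦(Gu + g) ≤ C δ` and
`|F(u) - F^*| ≤ C δ`. -/
def IsPrimalSol (C δ : ℝ) (u : E n) : Prop :=
  u ∈ P.U ∧ Metric.infDist (P.con u) P.K ≤ C * δ ∧ |P.F u - P.Fstar| ≤ C * δ

end QP

/-- Numbers of operations: projections on `U`, and products of a vector with `Q`, with `Gᵀ`. -/
@[ext]
structure Ops where
  projU : ℕ
  mulQ : ℕ
  mulGT : ℕ

/-- All three numbers of operations are at most `N`. -/
def Ops.AtMost (o : Ops) (N : ℕ) : Prop := o.projU ≤ N ∧ o.mulQ ≤ N ∧ o.mulGT ≤ N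

/-- Add up operation counts. -/
def Ops.add (a b : Ops) : Ops := ⟨a.projU + b.projU, a.mulQ + b.mulQ, a.mulGT + b.mulGT⟩

/-- The Nesterov sequence `θ_{k+1} = (1 + √(1 + 4θ_k²))/2`, started at `θ_0 = 0`,
so that `θ_1 = 1`. -/
def thetaFast : ℕ → ℝ
  | 0 => 0
  | k + 1 => (1 + Real.sqrt (1 + 4 * thetaFast k ^ 2)) / 2

/-- State of the first order method after `k` iterations: `x = x^k`, `y = y^{k+1}`,
and the operations done so far. -/
structure FOMState (n : ℕ) where
  x : E n
  y : E n
  ops : Ops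

/-- The first order method `FOM(φ, U)` for a function `φ` with gradient `grad` and parameters `L`
and `β_k`, started at `x⁰ = y¹ = x0`: for `k ≥ 1`,
`x^k = [y^k - (1/L)∇φ(y^k)]_U` and `y^{k+1} = x^k + β_k (x^k - x^{k-1})`.
It is used with `φ = 𝓛_ρ(·, μ)`, where an iteration takes one projection on `U` and one evaluation
of the gradient, that is, one product with `Q` and one with `Gᵀ`. -/
def fom {n : ℕ} (grad : E n → E n) (U : Set (E n)) (L : ℝ) (β : ℕ → ℝ) (x0 : E n) :
    ℕ → FOMState n
  | 0 => ⟨x0, x0, ⟨0, 0, 0⟩⟩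
  | k + 1 =>
    let S := fom grad U L β x0 k
    let x' := proj U (S.y - (1 / L) • grad S.y)
    ⟨x', x' + β (k + 1) • (x' - S.x), S.ops.add ⟨1, 1, 1⟩⟩

/-- The parameter `β_k` of the inner method: the fast gradient method for smooth convex functions
if `σ = 0`, the fast gradient method for strongly convex functions if `σ > 0`. -/
def innerBeta (L σ : ℝ) (k : ℕ) : ℝ :=
  if σ = 0 then (thetaFast k - 1) / thetaFast (k + 1)
  else (Real.sqrt L - Real.sqrt σ) / (Real.sqrt L + Real.sqrt σ)

/-- The two outer schemes: dual gradient method and dual fast gradient method. -/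
inductive Scheme
  | DGM
  | DFGM

/-- The sequence `θ_k`, `k ≥ 1`, of the outer scheme. -/
def Scheme.theta : Scheme → ℕ → ℝ
  | .DGM, _ => 1
  | .DFGM, k => thetaFast k

/-- The parameter `β_k = (θ_k - 1)/θ_{k+1}` of the outer scheme. -/
def Scheme.beta (c : Scheme) (k : ℕ) : ℝ := (c.theta k - 1) / c.theta (k + 1)

/-- State of the dual method after `k` outer iterations: `u = ū^k`, `lam = λ^k`, `mu = μ^{k+1}`,
and the operations done so far. -/
structure DFOMState (n p : ℕ) where
  u : E n
  lam : E p
  mu : E p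
  ops : Ops

namespace QP

variable {n p : ℕ} (P : QP n p)

/-- `m` iterations of `FOM(𝓛_ρ(·, μ), U)`, started at `x0`. -/
def inner (ρ : ℝ) (m : ℕ) (mu : E p) (x0 : E n) : FOMState n :=
  fom (P.gradLag ρ mu) P.U (P.LL ρ) (innerBeta (P.LL ρ) (P.sigmaL ρ)) x0 m

/-- The inexact dual first order method `DFOM(d_ρ, 𝒦_d)`, started at `λ⁰ = μ¹ = 0`. For `k ≥ 1`:
`ū^k` is the result of `m` iterations of `FOM(𝓛_ρ(·, μ^k), U)`, warm-started at `ū^{k-1}`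
(`ū⁰ = u0`); `λ^k = [μ^k + (1/(2L_d)) (G ū^k + g - s(ū^k, μ^k))]_{𝒦_d}`;
`μ^{k+1} = λ^k + β_k (λ^k - λ^{k-1})`. -/
def dfom (c : Scheme) (ρ : ℝ) (m : ℕ) (u0 : E n) : ℕ → DFOMState n p
  | 0 => ⟨u0, 0, 0, ⟨0, 0, 0⟩⟩
  | k + 1 =>
    let S := dfom c ρ m u0 k
    let I := P.inner ρ m S.mu S.u
    let lam' := proj P.Kd (S.mu + (1 / (2 * P.Ld ρ)) • P.dualGrad ρ I.x S.mu)
    ⟨I.x, lam', lam' + c.beta (k + 1) • (lam' - S.lam), S.ops.add I.ops⟩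

/-- The inner accuracy `ε_in`. -/
def epsIn (c : Scheme) (ρ ε : ℝ) : ℝ :=
  match c with
  | .DGM => ε / 4
  | .DFGM => ε * Real.sqrt ε / (8 * P.Rd ρ * Real.sqrt (2 * P.Ld ρ))

/-- The number of outer iterations `k_out`, rounded up. -/
def kOut (c : Scheme) (ρ ε : ℝ) : ℕ :=
  match c with
  | .DGM => ⌈8 * P.Ld ρ * P.Rd ρ ^ 2 / ε⌉₊
  | .DFGM => ⌈Real.sqrt (8 * P.Ld ρ * P.Rd ρ ^ 2 / ε)⌉₊

/-- The bound `k_total`. -/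
def kTotal (ρ ε : ℝ) : ℕ :=
  if P.sigmaL ρ = 0 then ⌊24 * P.normG * P.DU * P.Rd ρ / ε⌋₊
  else ⌊16 * P.normG * P.Rd ρ / Real.sqrt (P.sigmaL ρ * ε) *
    Real.log (8 * P.normG * P.DU * P.Rd ρ / ε)⌋₊

/-- `u` satisfies the inner criterion `0 ≤ 𝓛_ρ(u, μ) - d_ρ(μ) ≤ δ`. -/
def InnerOK (ρ δ : ℝ) (u : E n) (mu : E p) : Prop :=
  0 ≤ P.lag ρ u mu - P.dual ρ mu ∧ P.lag ρ u mu - P.dual ρ mu ≤ δ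

/-- The inner criterion holds for `ū^j` and `μ^j`, `j = 1, …, k`. -/
def RunOK (c : Scheme) (ρ δ : ℝ) (m : ℕ) (u0 : E n) (k : ℕ) : Prop :=
  ∀ j < k, P.InnerOK ρ δ (P.dfom c ρ m u0 (j + 1)).u (P.dfom c ρ m u0 j).mu

/-- The computation of the last primal iterate `ū(λ^k)`: after `k` outer iterations, the inner
problem at `λ^k` is solved by `m` iterations of `FOM`, warm-started at `ū^k`. -/
def last (c : Scheme) (ρ : ℝ) (m : ℕ) (u0 : E n) (k : ℕ) : FOMState n :=
  P.inner ρ m (P.dfom c ρ m u0 k).lam (P.dfom c ρ m u0 k).u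

/-- All operations done for the last primal iterate. -/
def lastOps (c : Scheme) (ρ : ℝ) (m : ℕ) (u0 : E n) (k : ℕ) : Ops :=
  (P.dfom c ρ m u0 k).ops.add (P.last c ρ m u0 k).ops

/-- The average primal iterate `û^k = ∑_{j=1}^k θ_j ū^j / S_k`, `S_k = ∑_{j=1}^k θ_j`. -/
def average (c : Scheme) (ρ : ℝ) (m : ℕ) (u0 : E n) (k : ℕ) : E n :=
  ∑ j ∈ Finset.Icc 1 k,
    (c.theta j / ∑ i ∈ Finset.Icc 1 k, c.theta i) • (P.dfom c ρ m u0 j).u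

end QP

/-- The number of inner iterations per inner problem when a total of `N` iterations is split evenly
among `s` inner problems, at least one for each. -/
def split (N s : ℕ) : ℕ := max 1 (N / s)

end DuQuad

end

open DuQuad

namespace DuQuad

/-! The choice `ρ = 8 R_d² / ε` collapses the outer loop. The bound on `lamMax P.Q` gives `8/9 ≤ L_d
ρ ≤ 1`, and `8 L_d R_d² / ε = L_d ρ`, so `k_out = 1` in both schemes (`kOut_eq_one`). The average
iterate is then one inexact minimizer of the augmented Lagrangian at the multiplier `0`, and the
last iterate is one at `λ¹`, where `‖λ¹‖ ≤ 5 R_d` (`norm_dfom_one_lam_le`). No convergence theory of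
the outer method is needed.

Two facts carry the proof. First, `L_𝓛 ε ≤ 9 (‖G‖ R_d)²`, so the classical rates of the fast
gradient method (`fom_rate_convex`, `fom_rate_strongly_convex`) yield accuracy `ε/4` already after
about half of `k_total` iterations (`innerOK_inner`); this leaves room for the second inner problem
of the last iterate. Second, let `v = Gu + g - s` be the residual of an `ε/2`-minimizer at a
multiplier of size `B R_d`. Comparing weak duality with the saddle inequality at a dual maximizer
cancels `F(u)` and leaves a quadratic inequality in `R_d ‖v‖`, whose solutions are `O(ε)`
(`isPrimalSol_of_innerOK`). -/

/-- A function with gradient map `grad` that lies between its linearizations plus `σ/2 ‖·‖²` and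
plus `L/2 ‖·‖²`. -/
structure IsSmoothConvex {n : ℕ} (f : E n → ℝ) (grad : E n → E n) (L σ : ℝ) : Prop where
  upper : ∀ x y, f x ≤ f y + inner ℝ (grad y) (x - y) + L / 2 * ‖x - y‖ ^ 2
  lower : ∀ x y, f y + inner ℝ (grad y) (x - y) + σ / 2 * ‖x - y‖ ^ 2 ≤ f x

/-! ### Convergence rates of the fast projected gradient method. -/

section FOM

variable {n : ℕ} {f : E n → ℝ} {grad : E n → E n} {U : Set (E n)} {L σ : ℝ}

/-- The three-point inequality behind both rates: the quadratic upper model at `y` is minimized over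
`U` at the projected gradient step, and its strong convexity supplies the term in `‖x - w‖²`. The
point `y` may lie outside `U`, as extrapolated points do. -/
theorem prox_step (hf : IsSmoothConvex f grad L σ) (hL : 0 < L) (hcl : IsClosed U)
    (hcv : Convex ℝ U) (y : E n) {w : E n} (hw : w ∈ U) :
    f (proj U (y - (1 / L) • grad y)) + L / 2 * ‖proj U (y - (1 / L) • grad y) - w‖ ^ 2
      ≤ f y + inner ℝ (grad y) (w - y) + L / 2 * ‖w - y‖ ^ 2 := by
  have h1 := proj_inner_le ⟨w, hw⟩ hcl hcv (y - (1 / L) • grad y) w hw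
  set x := proj U (y - (1 / L) • grad y) with hx
  have h2 := hf.upper x y
  set a := x - y with ha
  set b := w - y with hb
  have e1 : y - (1 / L) • grad y - x = -(a + (1 / L) • grad y) := by rw [ha]; abel
  have e2 : w - x = b - a := by rw [ha, hb]; abel
  have e3 : x - w = a - b := by rw [ha, hb]; abel
  rw [e1, e2, inner_neg_left, inner_add_left, inner_smul_left, inner_sub_right a,
    inner_sub_right (grad y), real_inner_self_eq_norm_sq] at h1
  simp only [conj_trivial] at h1
  rw [e3, norm_sub_sq_real]
  have h3 := mul_le_mul_of_nonneg_left h1 hL.le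
  have h4 : L * -(inner ℝ a b - ‖a‖ ^ 2 + 1 / L * (inner ℝ (grad y) b - inner ℝ (grad y) a))
      = -(L * inner ℝ a b - L * ‖a‖ ^ 2 + (inner ℝ (grad y) b - inner ℝ (grad y) a)) := by
    field_simp
  rw [h4] at h3
  linarith

theorem fom_x_mem (hne : U.Nonempty) (hcl : IsClosed U) (hcv : Convex ℝ U) (β : ℕ → ℝ) {x0 : E n}
    (hx0 : x0 ∈ U) : ∀ k, (fom grad U L β x0 k).x ∈ U
  | 0 => hx0
  | _ + 1 => (proj_isNearest hne hcl hcv _).1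

theorem fom_ops (grad : E n → E n) (U : Set (E n)) (L : ℝ) (β : ℕ → ℝ) (x0 : E n) : ∀ k, (fom grad U L β x0 k).ops = ⟨k, k, k⟩
  | 0 => rfl
  | k + 1 => by
    have h := fom_ops grad U L β x0 k
    simp only [fom, h, Ops.add]

theorem thetaFast_succ (k : ℕ) :
    1 ≤ thetaFast (k + 1) ∧ thetaFast (k + 1) * (thetaFast (k + 1) - 1) = thetaFast k ^ 2 := by
  have h0 : (1 : ℝ) ≤ 1 + 4 * thetaFast k ^ 2 := by nlinarith [sq_nonneg (thetaFast k)]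
  have h1 := Real.sq_sqrt (by linarith : 0 ≤ 1 + 4 * thetaFast k ^ 2)
  have h2 : 1 ≤ Real.sqrt (1 + 4 * thetaFast k ^ 2) := Real.one_le_sqrt.2 h0
  simp only [thetaFast]
  constructor
  · linarith
  · linarith [h1]

theorem thetaFast_one : thetaFast 1 = 1 := by
  simp [thetaFast]

theorem thetaFast_ge (k : ℕ) : ((k : ℝ) + 2) / 2 ≤ thetaFast (k + 1) := by
  induction k with
  | zero => simp [thetaFast_one]
  | succ k ih =>
    obtain ⟨h1, h2⟩ := thetaFast_succ (k + 1)
    have h3 : (0 : ℝ) ≤ k := k.cast_nonneg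
    push_cast
    by_contra! h
    nlinarith

/-- Convergence rate of the fast gradient method for smooth convex functions. -/
theorem fom_rate_convex (hf : IsSmoothConvex f grad L 0) (hL : 0 < L) (hcl : IsClosed U)
    (hcv : Convex ℝ U) {x0 z : E n} (hx0 : x0 ∈ U) (hz : z ∈ U) {m : ℕ} :
    thetaFast m ^ 2 * (f (fom grad U L (innerBeta L 0) x0 m).x - f z) ≤ L / 2 * ‖x0 - z‖ ^ 2 := by
  -- Nesterov's potential, nonincreasing in `k`. Since `θ_0 = 0`, the initial gap in `f` drops out
  -- and only the distance to `z` remains.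
  have key : ∀ k, thetaFast k ^ 2 * (f (fom grad U L (innerBeta L 0) x0 k).x - f z)
      + L / 2 * ‖thetaFast (k + 1) • (fom grad U L (innerBeta L 0) x0 k).y
        - (thetaFast (k + 1) - 1) • (fom grad U L (innerBeta L 0) x0 k).x - z‖ ^ 2
      ≤ L / 2 * ‖x0 - z‖ ^ 2 := by
    intro k
    induction k with
    | zero => simp [thetaFast, fom]
    | succ k ih =>
      refine le_trans ?_ ih
      have hxU := fom_x_mem (grad := grad) (L := L) ⟨z, hz⟩ hcl hcv (innerBeta L 0) hx0 k
      obtain ⟨ht1, htt⟩ := thetaFast_succ k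
      obtain ⟨hs1, -⟩ := thetaFast_succ (k + 1)
      have hβ : innerBeta L 0 (k + 1) = (thetaFast (k + 1) - 1) / thetaFast (k + 1 + 1) := by
        simp [innerBeta]
      simp only [fom]
      set x := (fom grad U L (innerBeta L 0) x0 k).x
      set y := (fom grad U L (innerBeta L 0) x0 k).y
      set x' := proj U (y - (1 / L) • grad y) with hx'
      set t := thetaFast (k + 1)
      set s := thetaFast (k + 1 + 1)
      rw [hβ]
      have ht0 : 0 < t := by linarith
      have hs0 : 0 < s := by linarith
      -- Comparing with this convex combination produces the weights `t² (1 - 1/t) = t (t - 1) =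
      -- θ_k²` on `f x` and `t` on `f z`, which is what telescoping requires.
      set w := (1 - 1 / t) • x + (1 / t) • z with hw
      have hwU : w ∈ U := hcv hxU hz (by
        rw [sub_nonneg]; exact (div_le_one ht0).2 ht1) (by positivity) (by ring)
      have hp := prox_step hf hL hcl hcv y hwU
      rw [← hx'] at hp
      have hfw : f y + inner ℝ (grad y) (w - y) ≤ (1 - 1 / t) * f x + 1 / t * f z := by
        have l1 := hf.lower x y
        have l2 := hf.lower z y
        have e : w - y = (1 - 1 / t) • (x - y) + (1 / t) • (z - y) := by
          rw [hw]; module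
        rw [e, inner_add_right, inner_smul_right, inner_smul_right]
        have c1 : 0 ≤ 1 - 1 / t := by rw [sub_nonneg]; exact (div_le_one ht0).2 ht1
        have c2 : 0 ≤ 1 / t := by positivity
        simp only [zero_div, zero_mul, add_zero] at l1 l2
        nlinarith [mul_le_mul_of_nonneg_left l1 c1, mul_le_mul_of_nonneg_left l2 c2]
      have e1 : s • (x' + ((t - 1) / s) • (x' - x)) - (s - 1) • x' - z = t • (x' - w) := by
        have c1 : s * ((t - 1) / s) = t - 1 := by field_simp
        have c2 : t * (1 - 1 / t) = t - 1 := by field_simp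
        have c3 : t * (1 / t) = 1 := by field_simp
        rw [hw, smul_add, smul_smul, c1, smul_sub t, smul_add t, smul_smul, smul_smul, c2, c3]
        module
      have e2 : t • y - (t - 1) • x - z = -(t • (w - y)) := by
        have c2 : t * (1 - 1 / t) = t - 1 := by field_simp
        have c3 : t * (1 / t) = 1 := by field_simp
        rw [hw, smul_sub, smul_add, smul_smul, smul_smul, c2, c3]
        module
      rw [e1, e2, norm_neg, norm_smul, norm_smul, Real.norm_eq_abs, abs_of_pos ht0, mul_pow,
        mul_pow]
      have h := mul_le_mul_of_nonneg_left (hp.trans (add_le_add_left hfw _))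
        (by positivity : 0 ≤ t ^ 2)
      have e3 : t ^ 2 * ((1 - 1 / t) * f x + 1 / t * f z + L / 2 * ‖w - y‖ ^ 2)
          = t * (t - 1) * f x + t * f z + L / 2 * (t ^ 2 * ‖w - y‖ ^ 2) := by
        field_simp
      rw [e3] at h
      have e4 : t * (t - 1) * f x + t * f z = thetaFast k ^ 2 * (f x - f z) + t ^ 2 * f z := by
        rw [← htt]; ring
      linarith
  have := key m
  have h0 : 0 ≤ L / 2 * ‖thetaFast (m + 1) • (fom grad U L (innerBeta L 0) x0 m).y
        - (thetaFast (m + 1) - 1) • (fom grad U L (innerBeta L 0) x0 m).x - z‖ ^ 2 := by positivity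
  linarith

/-- Convergence rate of the fast gradient method for smooth strongly convex functions. -/
theorem fom_rate_strongly_convex {α D : ℝ} (hα0 : 0 < α) (hα1 : α ≤ 1) (hL : 0 < L)
    (hf : IsSmoothConvex f grad L (α ^ 2 * L)) (hcl : IsClosed U)
    (hcv : Convex ℝ U) (hD : ∀ x ∈ U, ∀ y ∈ U, ‖x - y‖ ≤ D)
    {x0 z : E n} (hx0 : x0 ∈ U) (hz : z ∈ U) (m : ℕ) :
    f (fom grad U L (innerBeta L (α ^ 2 * L)) x0 (m + 1)).x - f z
      ≤ (1 - α) ^ m * (L / 2 * ((1 - α) * (2 + α)) * D ^ 2) := by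
  have hβ : ∀ k, innerBeta L (α ^ 2 * L) k = (1 - α) / (1 + α) := by
    intro k
    have hs : 0 < Real.sqrt L := Real.sqrt_pos.2 hL
    have h1 : Real.sqrt (α ^ 2 * L) = α * Real.sqrt L := by
      rw [Real.sqrt_mul (by positivity), Real.sqrt_sq hα0.le]
    rw [innerBeta, if_neg (by positivity), h1]
    field_simp
  have e1 : ∀ (x x' : E n), (1 + α) • (x' + ((1 - α) / (1 + α)) • (x' - x)) - x' - α • z
      = x' - ((1 - α) • x + α • z) := by
    intro x x'
    have c1 : (1 + α) * ((1 - α) / (1 + α)) = 1 - α := by field_simp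
    rw [smul_add, smul_smul, c1]
    module
  -- This potential contracts by `1 - α` per iteration. It starts after the first iteration: `f x0 -
  -- f z` is not controlled by `L D²` in a constrained problem, whereas the first step brings the
  -- potential below `L/2 ((1 - α²) + (1 - α)) D²`.
  have key : ∀ k, f (fom grad U L (innerBeta L (α ^ 2 * L)) x0 (k + 1)).x - f z
      + L / 2 * ‖(1 + α) • (fom grad U L (innerBeta L (α ^ 2 * L)) x0 (k + 1)).y
        - (fom grad U L (innerBeta L (α ^ 2 * L)) x0 (k + 1)).x - α • z‖ ^ 2
      ≤ (1 - α) ^ k * (L / 2 * ((1 - α) * (2 + α)) * D ^ 2) := by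
    intro k
    induction k with
    | zero =>
      have hx1 := fom_x_mem (grad := grad) (L := L) ⟨z, hz⟩ hcl hcv
        (innerBeta L (α ^ 2 * L)) hx0 1
      have hp := prox_step hf hL hcl hcv x0 hz
      have hl := hf.lower z x0
      simp only [fom, hβ, e1] at hx1 ⊢
      set x' := proj U (x0 - (1 / L) • grad x0)
      have d1 := pow_le_pow_left₀ (norm_nonneg _) (hD z hz x0 hx0) 2
      have d2 := pow_le_pow_left₀ (norm_nonneg _) (hD x' hx1 x0 hx0) 2
      have e2 : x' - ((1 - α) • x0 + α • z) = (1 - α) • (x' - x0) + α • (x' - z) := by module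
      have h3 : ‖x' - ((1 - α) • x0 + α • z)‖ ^ 2
          ≤ (1 - α) * ‖x' - x0‖ ^ 2 + α * ‖x' - z‖ ^ 2 := by
        have hc : 0 ≤ (1 - α) * α * ‖(x' - x0) - (x' - z)‖ ^ 2 :=
          mul_nonneg (mul_nonneg (by linarith) hα0.le) (sq_nonneg _)
        rw [norm_sub_sq_real] at hc
        rw [e2, norm_add_sq_real, norm_smul, norm_smul, mul_pow, mul_pow, Real.norm_eq_abs,
          Real.norm_eq_abs, sq_abs, sq_abs, inner_smul_left, inner_smul_right]
        simp only [conj_trivial]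
        linarith
      have m1 := mul_le_mul_of_nonneg_left h3 (by positivity : 0 ≤ L / 2)
      have m2 := mul_le_mul_of_nonneg_left d2
        (mul_nonneg (by positivity : 0 ≤ L / 2) (by linarith : 0 ≤ 1 - α))
      have m3 := mul_le_mul_of_nonneg_left d1
        (mul_nonneg (by positivity : 0 ≤ L / 2) (by nlinarith : 0 ≤ 1 - α ^ 2))
      have m4 : 0 ≤ L / 2 * (1 - α) * ‖x' - z‖ ^ 2 :=
        mul_nonneg (mul_nonneg (by positivity) (by linarith)) (sq_nonneg _)
      linarith
    | succ k ih =>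
      have hxU := fom_x_mem (grad := grad) (L := L) ⟨z, hz⟩ hcl hcv
        (innerBeta L (α ^ 2 * L)) hx0 (k + 1)
      rw [pow_succ (1 - α) k, mul_comm _ (1 - α), mul_assoc (1 - α)]
      refine le_trans ?_ (mul_le_mul_of_nonneg_left ih (by linarith : 0 ≤ 1 - α))
      rw [show fom grad U L (innerBeta L (α ^ 2 * L)) x0 (k + 1 + 1) = _ from rfl, fom]
      simp only [hβ, e1]
      set x := (fom grad U L (innerBeta L (α ^ 2 * L)) x0 (k + 1)).x
      set y := (fom grad U L (innerBeta L (α ^ 2 * L)) x0 (k + 1)).y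
      set x' := proj U (y - (1 / L) • grad y) with hx'
      have hwU : (1 - α) • x + α • z ∈ U := hcv hxU hz (by linarith) hα0.le (by ring)
      have hp := prox_step hf hL hcl hcv y hwU
      rw [← hx'] at hp
      have l1 := mul_le_mul_of_nonneg_left (hf.lower x y) (by linarith : 0 ≤ 1 - α)
      have l2 := mul_le_mul_of_nonneg_left (hf.lower z y) hα0.le
      set a := x - y with ha
      set b := z - y with hb
      have e3 : (1 - α) • x + α • z - y = (1 - α) • a + α • b := by rw [ha, hb]; module
      have e4 : (1 + α) • y - x - α • z = -(a + α • b) := by rw [ha, hb]; module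
      rw [e3, inner_add_right, inner_smul_right, inner_smul_right, norm_add_sq_real, norm_smul,
        norm_smul, mul_pow, mul_pow, Real.norm_eq_abs, Real.norm_eq_abs, sq_abs, sq_abs,
        inner_smul_left, inner_smul_right] at hp
      rw [e4, norm_neg, norm_add_sq_real, norm_smul, mul_pow, Real.norm_eq_abs, sq_abs,
        inner_smul_right]
      simp only [conj_trivial] at hp
      have m4 : 0 ≤ L / 2 * (1 - α) * (α + α ^ 2) * ‖a‖ ^ 2 :=
        mul_nonneg (mul_nonneg (mul_nonneg (by positivity) (by linarith)) (by positivity))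
          (sq_nonneg _)
      linarith
  have h0 : 0 ≤ L / 2 * ‖(1 + α) • (fom grad U L (innerBeta L (α ^ 2 * L)) x0 (m + 1)).y
        - (fom grad U L (innerBeta L (α ^ 2 * L)) x0 (m + 1)).x - α • z‖ ^ 2 := by positivity
  linarith [key m]

end FOM


/-! ### Rayleigh quotient bounds from the extreme eigenvalues. -/

section Spectrum

variable {n : ℕ} {A : Matrix (Fin n) (Fin n) ℝ}

theorem act_eigenvectorBasis (hA : A.IsHermitian) (i : Fin n) :
    act A (hA.eigenvectorBasis i) = hA.eigenvalues i • hA.eigenvectorBasis i := by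
  have h := hA.mulVec_eigenvectorBasis i
  ext j
  simpa [act, Matrix.toLpLin_apply] using congrFun h j

theorem inner_act_eq_sum (hA : A.IsHermitian) (d : E n) :
    inner ℝ d (act A d) = ∑ i, hA.eigenvalues i * inner ℝ (hA.eigenvectorBasis i) d ^ 2 := by
  rw [← hA.eigenvectorBasis.sum_inner_mul_inner d (act A d)]
  refine Finset.sum_congr rfl fun i _ => ?_
  have h : inner ℝ (hA.eigenvectorBasis i) (act A d)
      = inner ℝ (act A (hA.eigenvectorBasis i)) d :=
    ((Matrix.isSymmetric_toEuclideanLin_iff.2 hA) _ _).symm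
  rw [h, act_eigenvectorBasis, inner_smul_left, real_inner_comm d]
  simp only [conj_trivial]
  ring

theorem lamMin_mul_sq_le (hA : A.IsHermitian) (d : E n) :
    lamMin A * ‖d‖ ^ 2 ≤ inner ℝ d (act A d) := by
  rw [inner_act_eq_sum hA, ← hA.eigenvectorBasis.sum_sq_inner_right, Finset.mul_sum]
  refine Finset.sum_le_sum fun i _ => mul_le_mul_of_nonneg_right ?_ (sq_nonneg _)
  refine csInf_le ?_ (hA.eigenvalues_mem_spectrum_real i)
  rw [hA.spectrum_real_eq_range_eigenvalues]
  exact (Set.finite_range _).bddBelow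

theorem le_lamMax_mul_sq (hA : A.IsHermitian) (d : E n) :
    inner ℝ d (act A d) ≤ lamMax A * ‖d‖ ^ 2 := by
  rw [inner_act_eq_sum hA, ← hA.eigenvectorBasis.sum_sq_inner_right, Finset.mul_sum]
  refine Finset.sum_le_sum fun i _ => mul_le_mul_of_nonneg_right ?_ (sq_nonneg _)
  refine le_csSup ?_ (hA.eigenvalues_mem_spectrum_real i)
  rw [hA.spectrum_real_eq_range_eigenvalues]
  exact (Set.finite_range _).bddAbove

theorem lamMin_nonneg (hA : A.PosSemidef) : 0 ≤ lamMin A := by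
  refine Real.sInf_nonneg fun x hx => ?_
  rw [hA.isHermitian.spectrum_real_eq_range_eigenvalues] at hx
  obtain ⟨i, rfl⟩ := hx
  exact hA.eigenvalues_nonneg i

end Spectrum

/-! ### Smoothness and strong convexity of the augmented Lagrangian. -/

namespace QP

variable {n p : ℕ} (P : QP n p) {ρ : ℝ}

theorem sOpt_eq (hρ : 0 < ρ) (u : E n) (lam : E p) :
    P.sOpt ρ u lam = proj P.K (P.con u + (1 / ρ) • lam) := by
  unfold sOpt; rw [if_pos hρ]

theorem sOpt_mem (hρ : 0 < ρ) (u : E n) (lam : E p) : P.sOpt ρ u lam ∈ P.K := by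
  rw [P.sOpt_eq hρ]
  exact (proj_isNearest P.K_nonempty P.K_closed P.K_convex _).1

theorem posSemidef_hessian (hρ : 0 < ρ) : (P.Q + ρ • (P.G.transpose * P.G)).PosSemidef := by
  refine P.posSemidef.add (Matrix.PosSemidef.smul ?_ hρ.le)
  simpa using Matrix.posSemidef_conjTranspose_mul_self P.G

theorem inner_act_hessian (d : E n) :
    Inner.inner ℝ d (act (P.Q + ρ • (P.G.transpose * P.G)) d)
      = Inner.inner ℝ d (act P.Q d) + ρ * ‖act P.G d‖ ^ 2 := by
  have h : act (P.Q + ρ • (P.G.transpose * P.G)) d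
      = act P.Q d + ρ • act P.G.transpose (act P.G d) := by
    simp only [act, map_add, map_smul, LinearMap.coe_toContinuousLinearMap']
    simp [Matrix.toLpLin_apply, Matrix.mulVec_mulVec]
  rw [h, inner_add_right, inner_smul_right, real_inner_comm, real_inner_comm _ d, act_transpose,
    real_inner_self_eq_norm_sq, real_inner_comm]

theorem sigmaL_nonneg (hρ : 0 < ρ) : 0 ≤ P.sigmaL ρ := by
  unfold sigmaL
  split
  · exact lamMin_nonneg (P.posSemidef_hessian hρ)
  · exact lamMin_nonneg P.posSemidef

theorem sigmaL_mul_sq_le (hρ : 0 < ρ) (d : E n) :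
    P.sigmaL ρ * ‖d‖ ^ 2 ≤ Inner.inner ℝ d (act P.Q d) + ρ * ‖act P.G d‖ ^ 2 := by
  unfold sigmaL
  split
  · rw [← inner_act_hessian]
    exact lamMin_mul_sq_le (P.posSemidef_hessian hρ).isHermitian d
  · have := lamMin_mul_sq_le P.posSemidef.isHermitian d
    have : 0 ≤ ρ * ‖act P.G d‖ ^ 2 := by positivity
    linarith

theorem inner_act_add_le (hρ : 0 < ρ) (d : E n) :
    Inner.inner ℝ d (act P.Q d) + ρ * ‖act P.G d‖ ^ 2 ≤ P.LL ρ * ‖d‖ ^ 2 := by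
  have h1 := le_lamMax_mul_sq P.posSemidef.isHermitian d
  have h2 : ‖act P.G d‖ ^ 2 ≤ P.normG ^ 2 * ‖d‖ ^ 2 := by
    rw [← mul_pow]
    exact pow_le_pow_left₀ (norm_nonneg _) ((act P.G).le_opNorm d) 2
  have h3 := mul_le_mul_of_nonneg_left h2 hρ.le
  unfold LL
  linarith

theorem F_eq (u v : E n) :
    P.F v = P.F u + Inner.inner ℝ (act P.Q u + P.q) (v - u)
      + (1 / 2) * Inner.inner ℝ (v - u) (act P.Q (v - u)) := by
  obtain ⟨d, rfl⟩ : ∃ d, v = u + d := ⟨v - u, by abel⟩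
  have e1 := act_symm P.posSemidef u d
  have e2 := real_inner_comm d (act P.Q u)
  simp only [add_sub_cancel_left, F, map_add, inner_add_left, inner_add_right]
  linarith

theorem con_add (u d : E n) : P.con (u + d) = P.con u + act P.G d := by
  simp only [con, map_add]; abel

/-- The augmented Lagrangian satisfies the quadratic bounds with constants `L_𝓛` and `σ_𝓛`. -/
theorem isSmoothConvex_lag (hρ : 0 < ρ) (lam : E p) :
    IsSmoothConvex (fun v => P.lag ρ v lam) (P.gradLag ρ lam) (P.LL ρ) (P.sigmaL ρ) := by
  -- By completing the square, the penalty is `ρ/2` times a squared distance to `𝒦`, up to a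
  -- constant; `a` and `b` are the projection residuals at `v` and `u`. The second-order expansion
  -- isolates this term, and both bounds reduce to it.
  have key : ∀ v u : E n, ∃ a b : E p,
      a = P.con v - P.sOpt ρ v lam + (1 / ρ) • lam ∧
      b = P.con u - P.sOpt ρ u lam + (1 / ρ) • lam ∧
      P.lag ρ v lam = P.lag ρ u lam + Inner.inner ℝ (P.gradLag ρ lam u) (v - u)
        + (1 / 2) * Inner.inner ℝ (v - u) (act P.Q (v - u))
        + ρ / 2 * (‖a‖ ^ 2 - ‖b‖ ^ 2 - 2 * Inner.inner ℝ b (act P.G (v - u))) := by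
    intro v u
    refine ⟨_, _, rfl, rfl, ?_⟩
    set a := P.con v - P.sOpt ρ v lam + (1 / ρ) • lam with ha
    set b := P.con u - P.sOpt ρ u lam + (1 / ρ) • lam with hb
    have hlv : P.lag ρ v lam = P.F v + ρ / 2 * ‖a‖ ^ 2 - ‖lam‖ ^ 2 / (2 * ρ) := by
      rw [P.lag_eq hρ, add_assoc, lag_aux hρ]; ring
    have hlu : P.lag ρ u lam = P.F u + ρ / 2 * ‖b‖ ^ 2 - ‖lam‖ ^ 2 / (2 * ρ) := by
      rw [P.lag_eq hρ, add_assoc, lag_aux hρ]; ring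
    have hg : Inner.inner ℝ (P.gradLag ρ lam u) (v - u)
        = Inner.inner ℝ (act P.Q u + P.q) (v - u) + ρ * Inner.inner ℝ b (act P.G (v - u)) := by
      have : lam + ρ • (P.con u - P.sOpt ρ u lam) = ρ • b := by
        rw [hb, smul_add, smul_smul, mul_one_div_cancel hρ.ne', one_smul, add_comm]
      rw [gradLag, inner_add_left, act_transpose, this, inner_smul_left]
      simp
    rw [hlv, hlu, hg, P.F_eq u v]
    ring
  constructor
  · intro v u
    obtain ⟨a, b, ha, hb, h⟩ := key v u
    have hmin := (proj_isNearest P.K_nonempty P.K_closed P.K_convex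
      (P.con v + (1 / ρ) • lam)).2 (P.sOpt ρ u lam) (P.sOpt_mem hρ u lam)
    rw [← P.sOpt_eq hρ, add_sub_right_comm, ← ha] at hmin
    have hab : P.con v + (1 / ρ) • lam - P.sOpt ρ u lam = b + act P.G (v - u) := by
      rw [hb, show P.con v = P.con u + act P.G (v - u) by rw [← con_add]; congr 1; abel]; abel
    rw [hab] at hmin
    have h1 := pow_le_pow_left₀ (norm_nonneg _) hmin 2
    rw [norm_add_sq_real b] at h1
    have h2 := P.inner_act_add_le hρ (v - u)
    have h3 := mul_le_mul_of_nonneg_left h1 (by positivity : 0 ≤ ρ / 2)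
    simp only [h]
    linarith
  · intro v u
    obtain ⟨a, b, ha, hb, h⟩ := key v u
    have hcon : P.con v = P.con u + act P.G (v - u) := by rw [← con_add]; congr 1; abel
    simp only [h]
    unfold sigmaL
    split
    · next hk =>
      -- For `𝒦 = {0}` there is no projection, so the function is exactly quadratic with Hessian `Q
      -- + ρGᵀG`. In the other case the squared distance is only known to be convex, and `Q` alone
      -- provides the curvature.
      have hs : ∀ w, P.sOpt ρ w lam = 0 := fun w => by
        have := P.sOpt_mem hρ w lam
        rw [K, hk] at this
        exact this
      have hab : a = b + act P.G (v - u) := by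
        rw [ha, hb, hs, hs, hcon]; abel
      have h2 := lamMin_mul_sq_le (P.posSemidef_hessian hρ).isHermitian (v - u)
      rw [inner_act_hessian] at h2
      rw [hab, norm_add_sq_real b]
      linarith
    · have h2 := lamMin_mul_sq_le P.posSemidef.isHermitian (v - u)
      have hvi := proj_inner_le P.K_nonempty P.K_closed P.K_convex (P.con u + (1 / ρ) • lam)
        (P.sOpt ρ v lam) (P.sOpt_mem hρ v lam)
      rw [← P.sOpt_eq hρ, add_sub_right_comm, ← hb] at hvi
      have hab : a = b + (act P.G (v - u) - (P.sOpt ρ v lam - P.sOpt ρ u lam)) := by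
        rw [ha, hb, hcon]; abel
      have h3 : 0 ≤ ρ / 2 * (‖a‖ ^ 2 - ‖b‖ ^ 2 - 2 * Inner.inner ℝ b (act P.G (v - u))) := by
        refine mul_nonneg (by positivity) ?_
        rw [hab, norm_add_sq_real b, inner_sub_right]
        nlinarith [sq_nonneg ‖act P.G (v - u) - (P.sOpt ρ v lam - P.sOpt ρ u lam)‖]
      linarith

/-! ### Duality for the augmented Lagrangian. -/

theorem continuous_lag (hρ : 0 < ρ) (lam : E p) : Continuous fun v => P.lag ρ v lam :=
  continuous_iff_continuousAt.2 fun u => (P.hasGradientAt_lag hρ lam u).continuousAt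

theorem lag_le (hρ : 0 < ρ) (u : E n) (lam : E p) {s : E p} (hs : s ∈ P.K) :
    P.lag ρ u lam ≤ P.F u + Inner.inner ℝ lam (P.con u - s) + ρ / 2 * ‖P.con u - s‖ ^ 2 := by
  have hmin := (proj_isNearest P.K_nonempty P.K_closed P.K_convex
    (P.con u + (1 / ρ) • lam)).2 s hs
  rw [← P.sOpt_eq hρ, add_sub_right_comm, add_sub_right_comm] at hmin
  have h := mul_le_mul_of_nonneg_left (pow_le_pow_left₀ (norm_nonneg _) hmin 2)
    (by positivity : 0 ≤ ρ / 2)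
  rw [P.lag_eq hρ]
  linarith [lag_aux hρ (P.con u - P.sOpt ρ u lam) lam, lag_aux hρ (P.con u - s) lam]

theorem exists_lag_eq_dual (hρ : 0 < ρ) (hU : P.U.Nonempty) (lam : E p) :
    ∃ z ∈ P.U, P.lag ρ z lam = P.dual ρ lam ∧ ∀ u ∈ P.U, P.dual ρ lam ≤ P.lag ρ u lam := by
  obtain ⟨z, hz, hmin⟩ := P.compact_U.exists_isMinOn hU (P.continuous_lag hρ lam).continuousOn
  have h : IsLeast ((fun u => P.lag ρ u lam) '' P.U) (P.lag ρ z lam) :=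
    ⟨⟨z, hz, rfl⟩, by rintro _ ⟨u, hu, rfl⟩; exact hmin hu⟩
  have e : P.dual ρ lam = P.lag ρ z lam := h.csInf_eq
  exact ⟨z, hz, e.symm, fun u hu => e ▸ hmin hu⟩

theorem continuous_F : Continuous P.F := by
  unfold F; fun_prop

theorem continuous_con : Continuous P.con := by
  unfold con; fun_prop

theorem exists_F_eq_Fstar (hf : P.feasible.Nonempty) : ∃ z ∈ P.feasible, P.F z = P.Fstar := by
  have hc : IsCompact P.feasible :=
    P.compact_U.inter_right (P.K_closed.preimage P.continuous_con)
  obtain ⟨z, hz, hmin⟩ := hc.exists_isMinOn hf P.continuous_F.continuousOn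
  have h : IsLeast (P.F '' P.feasible) (P.F z) :=
    ⟨⟨z, hz, rfl⟩, by rintro _ ⟨u, hu, rfl⟩; exact hmin hu⟩
  exact ⟨z, hz, h.csInf_eq.symm⟩

/-- Weak duality. -/
theorem dual_le_Fstar (hρ : 0 < ρ) (hf : P.feasible.Nonempty) (lam : E p) :
    P.dual ρ lam ≤ P.Fstar := by
  obtain ⟨z, ⟨hzU, hzK⟩, hz⟩ := P.exists_F_eq_Fstar hf
  obtain ⟨-, -, -, h⟩ := P.exists_lag_eq_dual hρ ⟨z, hzU⟩ lam
  have := (h z hzU).trans (P.lag_le hρ z lam hzK)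
  simpa [hz] using this

theorem IsLagrangeMultiplier.Fstar_le_dual {P : QP n p} (hρ : 0 < ρ) {lam : E p}
    (h : P.IsLagrangeMultiplier lam) : P.Fstar ≤ P.dual ρ lam := by
  obtain ⟨⟨w, hwU, -⟩, h⟩ := h
  obtain ⟨z, hz, e, -⟩ := P.exists_lag_eq_dual hρ ⟨w, hwU⟩ lam
  rw [← e, P.lag_eq hρ]
  have := h z hz _ (P.sOpt_mem hρ z lam)
  have : 0 ≤ ρ / 2 * ‖P.con z - P.sOpt ρ z lam‖ ^ 2 := by positivity
  linarith

theorem IsLagrangeMultiplier.mem_Kd {P : QP n p} {lam : E p}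
    (h : P.IsLagrangeMultiplier lam) : lam ∈ P.Kd := by
  unfold Kd
  split
  · next hk =>
    obtain ⟨⟨w, hwU, hwK⟩, h⟩ := h
    intro i
    by_contra! hi
    have hKe : P.K = {y | ∀ i, y i ≤ 0} := by rw [K, hk.2]; rfl
    -- If `lam i < 0`, moving `s` far along the negative `i`-th axis lowers the Lagrangian by `t`,
    -- hence below `F^*`.
    set t : ℝ := |P.F w + Inner.inner ℝ lam (P.con w) - P.Fstar| + 1 with ht
    have ht0 : 0 < t := by positivity
    have := h w hwU (-(t / (-lam i)) • EuclideanSpace.single i 1) (by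
      rw [hKe]
      intro j
      have : 0 < t / (-lam i) := div_pos ht0 (by linarith)
      by_cases hj : j = i
      · simp [hj]; linarith
      · simp [hj])
    rw [inner_sub_right, inner_smul_right, EuclideanSpace.inner_single_right] at this
    simp only [one_mul, conj_trivial] at this
    have e : -(t / -lam i) * lam i = t := by field_simp [hi.ne]
    rw [e] at this
    linarith [le_abs_self (P.F w + Inner.inner ℝ lam (P.con w) - P.Fstar)]
  · trivial

theorem zero_mem_Kd : (0 : E p) ∈ P.Kd := by
  unfold Kd
  split
  · intro i; simp
  · trivial

theorem Kd_closed : IsClosed P.Kd := by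
  unfold Kd
  split
  · simp only [Set.ofPred_forall]
    exact isClosed_iInter fun i => isClosed_le continuous_const (by fun_prop)
  · exact isClosed_univ

theorem Kd_convex : Convex ℝ P.Kd := by
  unfold Kd
  split
  · intro x hx y hy a b ha hb _ i
    simpa using add_nonneg (mul_nonneg ha (hx i)) (mul_nonneg hb (hy i))
  · exact convex_univ

theorem norm_proj_Kd_le (x : E p) : ‖proj P.Kd x‖ ≤ ‖x‖ := by
  have h := proj_inner_le ⟨0, P.zero_mem_Kd⟩ P.Kd_closed P.Kd_convex x 0 P.zero_mem_Kd
  rw [zero_sub, inner_neg_right, inner_sub_left, real_inner_self_eq_norm_sq] at h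
  have h2 := real_inner_le_norm x (proj P.Kd x)
  by_contra! hlt
  nlinarith [norm_nonneg x]

/-- If `G = 0`, the constraint value is a fixed point of `𝒦`, so the multiplier `0` is already dual
optimal and `R_d = 0`. -/
theorem normG_pos (hρ : 0 < ρ) (hf : P.feasible.Nonempty) (hR : 0 < P.Rd ρ) : 0 < P.normG := by
  refine lt_of_le_of_ne (norm_nonneg _) fun h => ?_
  have hG : act P.G = 0 := norm_eq_zero.1 h.symm
  have hcon : ∀ u, P.con u = P.g := fun u => by simp [con, hG]
  obtain ⟨w, hwU, hwK⟩ := hf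
  have hopt : (0 : E p) ∈ P.dualOpt ρ := by
    refine ⟨P.zero_mem_Kd, fun nu _ => ?_⟩
    obtain ⟨z, hz, e, -⟩ := P.exists_lag_eq_dual hρ ⟨w, hwU⟩ 0
    obtain ⟨-, -, -, h2⟩ := P.exists_lag_eq_dual hρ ⟨w, hwU⟩ nu
    have h3 := (h2 z hz).trans (P.lag_le hρ z nu hwK)
    rw [hcon, hcon, sub_self] at h3
    rw [← e, P.lag_eq hρ]
    have : 0 ≤ ρ / 2 * ‖P.con z - P.sOpt ρ z 0‖ ^ 2 := by positivity
    simp only [inner_zero_left, inner_zero_right, norm_zero] at h3 ⊢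
    linarith
  have := Metric.infDist_zero_of_mem hopt
  rw [Rd] at hR
  linarith

/-- The factor `2` avoids proving that the distance is attained. Positivity of `R_d` also rules out
an empty `Λ^*`, whose `infDist` is `0` by convention. -/
theorem exists_dualOpt_norm_le (hR : 0 < P.Rd ρ) : ∃ lam ∈ P.dualOpt ρ, ‖lam‖ ≤ 2 * P.Rd ρ := by
  have hne : (P.dualOpt ρ).Nonempty := by
    by_contra! h
    rw [Rd, h, Metric.infDist_empty] at hR
    exact lt_irrefl _ hR
  obtain ⟨lam, h1, h2⟩ := (Metric.infDist_lt_iff hne).1 (show P.Rd ρ < 2 * P.Rd ρ by linarith)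
  rw [dist_zero_left] at h2
  exact ⟨lam, h1, h2.le⟩

/-- Maximizers of the augmented dual function are Lagrange multipliers. -/
theorem Fstar_le_of_mem_dualOpt (hρ : 0 < ρ) {nu lam : E p} (hnu : P.IsLagrangeMultiplier nu)
    (hlam : lam ∈ P.dualOpt ρ) {u : E n} (hu : u ∈ P.U) {s : E p} (hs : s ∈ P.K) :
    P.Fstar ≤ P.F u + Inner.inner ℝ lam (P.con u - s) := by
  have hd : P.Fstar ≤ P.dual ρ lam := (hnu.Fstar_le_dual hρ).trans (hlam.2 nu hnu.mem_Kd)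
  obtain ⟨z, ⟨hzU, hzK⟩, hz⟩ := P.exists_F_eq_Fstar hnu.1
  obtain ⟨-, -, -, h2⟩ := P.exists_lag_eq_dual hρ ⟨z, hzU⟩ lam
  set v := P.con u - s with hv
  by_contra! hlt
  set δ := P.Fstar - (P.F u + Inner.inner ℝ lam v) with hδ
  have hδ0 : 0 < δ := by linarith
  -- Move a fraction `t` from the optimal pair `(z, Gz + g)` towards `(u, s)`. A violation `δ`
  -- enters to first order in `t`, the penalty only to second order, so small `t` gives a
  -- contradiction.
  have key : ∀ t : ℝ, 0 < t → t ≤ 1 → δ ≤ t * (ρ / 2 * ‖v‖ ^ 2) := by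
    intro t ht0 ht1
    have hUt : (1 - t) • z + t • u ∈ P.U := P.convex_U hzU hu (by linarith) ht0.le (by ring)
    have hKt : (1 - t) • P.con z + t • s ∈ P.K :=
      P.K_convex hzK hs (by linarith) ht0.le (by ring)
    have h3 := hd.trans ((h2 _ hUt).trans (P.lag_le hρ _ lam hKt))
    have e1 : P.con ((1 - t) • z + t • u) - ((1 - t) • P.con z + t • s) = t • v := by
      rw [hv]; simp only [con, map_add, map_smul]; module
    rw [e1, inner_smul_right, norm_smul, mul_pow, Real.norm_eq_abs, sq_abs] at h3
    have hF : P.F ((1 - t) • z + t • u) ≤ (1 - t) * P.F z + t * P.F u := by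
      set y := (1 - t) • z + t • u with hy
      have f1 := P.F_eq y z
      have f2 := P.F_eq y u
      have g1 := act_nonneg P.posSemidef (z - y)
      have g2 := act_nonneg P.posSemidef (u - y)
      have e : Inner.inner ℝ (act P.Q y + P.q) ((1 - t) • (z - y) + t • (u - y)) = (0 : ℝ) := by
        rw [show (1 - t) • (z - y) + t • (u - y) = 0 by rw [hy]; module, inner_zero_right]
      rw [inner_add_right, inner_smul_right, inner_smul_right] at e
      have m1 := mul_nonneg (by linarith : 0 ≤ 1 - t) g1
      have m2 := mul_nonneg ht0.le g2
      rw [f1, f2]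
      linarith
    rw [hz] at hF
    have h4 : t * δ ≤ t * (t * (ρ / 2 * ‖v‖ ^ 2)) := by
      rw [hδ]; linarith
    exact le_of_mul_le_mul_left h4 ht0
  set c := ρ / 2 * ‖v‖ ^ 2 with hc
  have hc0 : 0 ≤ c := by positivity
  have hk := key (δ / (δ + c)) (by positivity) ((div_le_one (by positivity)).2 (by linarith))
  rw [div_mul_eq_mul_div, le_div_iff₀ (by positivity)] at hk
  nlinarith

end QP

/-! ### Iteration counts for the inner problems. -/

/-- All factors are bounded by exponentials, using `(1 - α)(2 + α) = 2 (1 - α/2 - α²/2)`. The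
exponents add up to `-mα/4 + α - α²/2 ≤ 1/2`, and `2 √e ≤ 32/9`. This constant is the one for which
`9/128 · 32/9 = 1/4` in `innerOK_inner`. -/
theorem pow_mul_sq_le_of_log_le {α X : ℝ} {m : ℕ} (hα0 : 0 < α) (hα1 : α ≤ 1) (hX : 0 < X)
    (h : Real.log X ≤ 3 / 8 * (m + 2) * α) :
    (1 - α) ^ m * ((1 - α) * (2 + α)) * X ^ 2 ≤ 32 / 9 := by
  have h1 : X ^ 2 ≤ Real.exp (3 / 4 * (m + 2) * α) := by
    rw [← Real.exp_log hX, ← Real.exp_nat_mul]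
    refine Real.exp_le_exp.2 ?_
    push_cast
    linarith
  have h2 : (1 - α) ^ m ≤ Real.exp (m * -α) := by
    rw [Real.exp_nat_mul]
    exact pow_le_pow_left₀ (by linarith) (by linarith [Real.add_one_le_exp (-α)]) m
  have h3 : (1 - α) * (2 + α) ≤ 2 * Real.exp (-α / 2 - α ^ 2 / 2) := by
    have := Real.add_one_le_exp (-α / 2 - α ^ 2 / 2)
    linarith
  have h4 : 0 ≤ (1 - α) * (2 + α) := mul_nonneg (by linarith) (by linarith)
  have h5 : Real.exp (1 / 2) ≤ 16 / 9 := by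
    have e : Real.exp (1 / 2) ^ 2 = Real.exp 1 := by
      rw [← Real.exp_nat_mul]; norm_num
    have := Real.exp_one_lt_d9
    exact le_of_sq_le_sq (by rw [e]; norm_num; linarith) (by norm_num)
  calc (1 - α) ^ m * ((1 - α) * (2 + α)) * X ^ 2
      ≤ Real.exp (m * -α) * (2 * Real.exp (-α / 2 - α ^ 2 / 2))
          * Real.exp (3 / 4 * (m + 2) * α) := by gcongr
    _ = 2 * Real.exp (m * -α + (-α / 2 - α ^ 2 / 2) + 3 / 4 * (m + 2) * α) := by
        rw [Real.exp_add, Real.exp_add]; ring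
    _ ≤ 2 * Real.exp (1 / 2) := by
        refine mul_le_mul_of_nonneg_left (Real.exp_le_exp.2 ?_) (by norm_num)
        have : 0 ≤ (m : ℝ) * α := by positivity
        nlinarith [sq_nonneg (1 - α)]
    _ ≤ 32 / 9 := by linarith

namespace QP

variable {n p : ℕ} (P : QP n p) {ε ρ : ℝ}

theorem exists_ne_zero_of_normG_pos (hG : 0 < P.normG) : ∃ d : E n, d ≠ 0 := by
  by_contra! h
  have : act P.G = 0 := by ext1 d; simp [h d]
  rw [normG, this, norm_zero] at hG
  exact lt_irrefl _ hG

theorem lamMin_le_lamMax (hG : 0 < P.normG) : lamMin P.Q ≤ lamMax P.Q := by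
  obtain ⟨d, hd⟩ := P.exists_ne_zero_of_normG_pos hG
  have h := (lamMin_mul_sq_le P.posSemidef.isHermitian d).trans
    (le_lamMax_mul_sq P.posSemidef.isHermitian d)
  exact le_of_mul_le_mul_right h (pow_pos (norm_pos_iff.2 hd) 2)

theorem sigmaL_le_LL (hρ : 0 < ρ) (hG : 0 < P.normG) : P.sigmaL ρ ≤ P.LL ρ := by
  obtain ⟨d, hd⟩ := P.exists_ne_zero_of_normG_pos hG
  have h := (P.sigmaL_mul_sq_le hρ d).trans (P.inner_act_add_le hρ d)
  exact le_of_mul_le_mul_right h (pow_pos (norm_pos_iff.2 hd) 2)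

theorem LL_pos (hρ : 0 < ρ) (hG : 0 < P.normG) : 0 < P.LL ρ := by
  have h1 := P.lamMin_le_lamMax hG
  have h2 := lamMin_nonneg P.posSemidef
  have : 0 < ρ * P.normG ^ 2 := by positivity
  unfold LL
  linarith

theorem inner_mem (ρ : ℝ) (m : ℕ) (mu : E p) {x0 : E n} (hx0 : x0 ∈ P.U) :
    (P.inner ρ m mu x0).x ∈ P.U :=
  fom_x_mem ⟨x0, hx0⟩ P.compact_U.isClosed P.convex_U _ hx0 m

/-- The inner problems are solved to accuracy `ε/4` after about half of `kTotal` iterations. -/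
theorem innerOK_inner (hε : 0 < ε) (hR : 0 < P.Rd ρ) (hG : 0 < P.normG)
    (hQ : lamMax P.Q ≤ P.normG ^ 2 * P.Rd ρ ^ 2 / ε) (hρ : ρ = 8 * P.Rd ρ ^ 2 / ε) {m : ℕ}
    (hm : 1 ≤ m) (hk : P.kTotal ρ ε < 2 * (m + 1)) (mu : E p) {x0 : E n} (hx0 : x0 ∈ P.U) :
    P.InnerOK ρ (ε / 4) (P.inner ρ m mu x0).x mu := by
  have hρ0 : 0 < ρ := by rw [hρ]; positivity
  have hmem := P.inner_mem ρ m mu hx0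
  obtain ⟨z, hz, e, hdual⟩ := P.exists_lag_eq_dual hρ0 ⟨x0, hx0⟩ mu
  refine ⟨sub_nonneg.2 (hdual _ hmem), ?_⟩
  rw [← e]
  have hsm := P.isSmoothConvex_lag hρ0 mu
  have hL := P.LL_pos hρ0 hG
  have hcl := P.compact_U.isClosed
  have hD : ∀ x ∈ P.U, ∀ y ∈ P.U, ‖x - y‖ ≤ P.DU := fun x hx y hy => by
    rw [← dist_eq_norm]
    exact Metric.dist_le_diam_of_mem P.compact_U.isBounded hx hy
  have hD0 : 0 ≤ P.DU := Metric.diam_nonneg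
  have hLε : P.LL ρ * ε ≤ 9 * (P.normG * P.Rd ρ) ^ 2 := by
    have h1 := (le_div_iff₀ hε).1 hQ
    have h2 : ρ * ε = 8 * P.Rd ρ ^ 2 := (eq_div_iff hε.ne').1 hρ
    unfold LL
    have h3 : (lamMax P.Q + ρ * P.normG ^ 2) * ε = lamMax P.Q * ε + ρ * ε * P.normG ^ 2 := by ring
    rw [h3, h2]
    linarith
  unfold kTotal at hk
  unfold inner
  split_ifs at hk with hσ
  · rw [hσ] at hsm ⊢
    have hr := fom_rate_convex hsm hL hcl P.convex_U hx0 hz (m := m)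
    set r := P.lag ρ (fom (P.gradLag ρ mu) P.U (P.LL ρ) (innerBeta (P.LL ρ) 0) x0 m).x mu
      - P.lag ρ z mu
    have hk' := Nat.lt_of_floor_lt hk
    rw [div_lt_iff₀ hε] at hk'
    push_cast at hk'
    obtain ⟨k, rfl⟩ : ∃ k, m = k + 1 := ⟨m - 1, by omega⟩
    have ht := thetaFast_ge k
    set t := thetaFast (k + 1)
    push_cast at hk'
    have ht0 : 0 < t := by
      have : (0 : ℝ) ≤ k := k.cast_nonneg
      linarith
    -- From `θ_m ≥ (m + 1)/2` and `24 ‖G‖ D_U R_d / ε < 2(m + 1)`.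
    have h1 : 6 * (P.normG * P.Rd ρ * P.DU) ≤ t * ε := by
      have := mul_le_mul_of_nonneg_right ht hε.le
      linarith
    have h2 := pow_le_pow_left₀ (by positivity) h1 2
    have h3 := pow_le_pow_left₀ (norm_nonneg _) (hD x0 hx0 z hz) 2
    have h4 := hr.trans (mul_le_mul_of_nonneg_left h3 (by positivity : 0 ≤ P.LL ρ / 2))
    have h5 := mul_le_mul_of_nonneg_right hLε (by positivity : 0 ≤ P.DU ^ 2)
    have h6 : t ^ 2 * r * ε ≤ t ^ 2 * (ε / 4) * ε := by
      have := mul_le_mul_of_nonneg_right h4 hε.le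
      nlinarith
    exact le_of_mul_le_mul_left (le_of_mul_le_mul_right h6 hε) (by positivity)
  · have hσ0 : 0 < P.sigmaL ρ := lt_of_le_of_ne (P.sigmaL_nonneg hρ0) (Ne.symm hσ)
    set α := Real.sqrt (P.sigmaL ρ / P.LL ρ) with hα
    have hα0 : 0 < α := Real.sqrt_pos.2 (by positivity)
    have hα1 : α ≤ 1 := Real.sqrt_le_one.2 ((div_le_one hL).2 (P.sigmaL_le_LL hρ0 hG))
    have hα2 : α ^ 2 * P.LL ρ = P.sigmaL ρ := by
      rw [hα, Real.sq_sqrt (by positivity)]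
      field_simp
    rw [← hα2] at hsm ⊢
    obtain ⟨k, rfl⟩ : ∃ k, m = k + 1 := ⟨m - 1, by omega⟩
    refine (fom_rate_strongly_convex hα0 hα1 hL hsm hcl P.convex_U hD hx0 hz k).trans ?_
    -- A zero diameter is treated apart because the logarithm needs a positive argument; the rate
    -- bound vanishes there.
    rcases hD0.eq_or_lt with h0 | hDpos
    · rw [← h0]
      norm_num
      positivity
    set X := 8 * P.normG * P.DU * P.Rd ρ / ε with hX
    have hXpos : 0 < X := by positivity
    have hk' := Nat.lt_of_floor_lt hk
    have hs0 : 0 < Real.sqrt (P.sigmaL ρ * ε) := Real.sqrt_pos.2 (by positivity)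
    rw [div_mul_eq_mul_div, div_lt_iff₀ hs0] at hk'
    push_cast at hk'
    -- Since `σ_𝓛 = α² L_𝓛`, the bound on `L_𝓛 ε` turns the count `k_total` into a multiple of `log
    -- X / α`.
    have hs : Real.sqrt (P.sigmaL ρ * ε) ≤ 3 * (P.normG * P.Rd ρ) * α := by
      refine Real.sqrt_le_iff.2 ⟨by positivity, ?_⟩
      rw [← hα2]
      have := mul_le_mul_of_nonneg_left hLε (sq_nonneg α)
      linarith
    have hlog : Real.log X ≤ 3 / 8 * (k + 2) * α := by
      have h1 := mul_le_mul_of_nonneg_left hs (by positivity : (0 : ℝ) ≤ 2 * (k + 1 + 1))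
      have h2 : P.normG * P.Rd ρ * Real.log X ≤ P.normG * P.Rd ρ * (3 / 8 * (k + 2) * α) := by
        linarith
      exact le_of_mul_le_mul_left h2 (by positivity)
    have hfin := pow_mul_sq_le_of_log_le hα0 hα1 hXpos hlog
    set c := (1 - α) ^ k * ((1 - α) * (2 + α))
    have hc : 0 ≤ c := mul_nonneg (pow_nonneg (by linarith) _)
      (mul_nonneg (by linarith) (by linarith))
    have hLX : P.LL ρ / 2 * P.DU ^ 2 ≤ 9 / 128 * ε * X ^ 2 := by
      have h5 := mul_le_mul_of_nonneg_right hLε (by positivity : 0 ≤ P.DU ^ 2)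
      rw [hX, div_pow, ← sub_nonneg]
      have : 9 / 128 * ε * ((8 * P.normG * P.DU * P.Rd ρ) ^ 2 / ε ^ 2) - P.LL ρ / 2 * P.DU ^ 2
          = (9 * (P.normG * P.Rd ρ) ^ 2 * P.DU ^ 2 - P.LL ρ * ε * P.DU ^ 2) / (2 * ε) := by
        field_simp
        ring
      rw [this]
      exact div_nonneg (by linarith) (by positivity)
    have h7 := mul_le_mul_of_nonneg_left hLX hc
    have h8 := mul_le_mul_of_nonneg_left hfin (by positivity : 0 ≤ 9 / 128 * ε)
    linarith

/-! ### Collapse of the outer loop and recovery of primal solutions. -/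

/-- The hypothesis on `lamMax P.Q` says that `Q` contributes at most `ρ‖G‖²/8` to the denominator of
`L_d`, whence `1/(1 + 1/8) = 8/9`. -/
theorem Ld_mul_bounds (hε : 0 < ε) (hG : 0 < P.normG) (hR : 0 < P.Rd ρ)
    (hQ : lamMax P.Q ≤ P.normG ^ 2 * P.Rd ρ ^ 2 / ε) (hρ : ρ = 8 * P.Rd ρ ^ 2 / ε) :
    0 < P.Ld ρ ∧ 8 / 9 ≤ P.Ld ρ * ρ ∧ P.Ld ρ * ρ ≤ 1 := by
  have hρ0 : 0 < ρ := by rw [hρ]; positivity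
  have h1 := P.lamMin_le_lamMax hG
  have h2 := lamMin_nonneg P.posSemidef
  have h3 : P.normG ^ 2 * P.Rd ρ ^ 2 / ε = ρ * P.normG ^ 2 / 8 := by
    nth_rewrite 2 [hρ]
    ring
  have h4 : 0 < ρ * P.normG ^ 2 := by positivity
  unfold Ld
  refine ⟨by positivity, ?_, ?_⟩
  · rw [div_mul_eq_mul_div, le_div_iff₀ (by positivity)]
    linarith
  · rw [div_mul_eq_mul_div, div_le_one (by positivity)]
    linarith

theorem kOut_eq_one (hε : 0 < ε) (hG : 0 < P.normG) (hR : 0 < P.Rd ρ)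
    (hQ : lamMax P.Q ≤ P.normG ^ 2 * P.Rd ρ ^ 2 / ε) (hρ : ρ = 8 * P.Rd ρ ^ 2 / ε)
    (c : Scheme) : P.kOut c ρ ε = 1 := by
  obtain ⟨h1, -, h3⟩ := P.Ld_mul_bounds hε hG hR hQ hρ
  have hρ0 : 0 < ρ := by rw [hρ]; positivity
  have e : 8 * P.Ld ρ * P.Rd ρ ^ 2 / ε = P.Ld ρ * ρ := by
    nth_rewrite 4 [hρ]
    ring
  unfold kOut
  rw [e]
  cases c
  · exact (Nat.ceil_eq_iff one_ne_zero).2 ⟨by simp; positivity, by simpa using h3⟩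
  · exact (Nat.ceil_eq_iff one_ne_zero).2 ⟨by simp; positivity, by simpa using h3⟩

/-- For DFGM, `(2 R_d √(2 L_d))² = L_d ρ ε` lies between `8ε/9` and `ε`. Hence both schemes may be
treated alike: `ε/4` is what the inner method must reach, `ε/2` what primal recovery may assume. -/
theorem epsIn_bounds (hε : 0 < ε) (hG : 0 < P.normG) (hR : 0 < P.Rd ρ)
    (hQ : lamMax P.Q ≤ P.normG ^ 2 * P.Rd ρ ^ 2 / ε) (hρ : ρ = 8 * P.Rd ρ ^ 2 / ε)
    (c : Scheme) : ε / 4 ≤ P.epsIn c ρ ε ∧ P.epsIn c ρ ε ≤ ε / 2 := by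
  obtain ⟨h1, h2, h3⟩ := P.Ld_mul_bounds hε hG hR hQ hρ
  unfold epsIn
  cases c
  · constructor <;> dsimp only <;> linarith
  · dsimp only
    set s := Real.sqrt (2 * P.Ld ρ) with hs
    set e := Real.sqrt ε with he
    have hs0 : 0 < s := Real.sqrt_pos.2 (by positivity)
    have he0 : 0 < e := Real.sqrt_pos.2 hε
    have hs2 : s ^ 2 = 2 * P.Ld ρ := Real.sq_sqrt (by positivity)
    have he2 : e ^ 2 = ε := Real.sq_sqrt hε.le
    have h4 : (2 * P.Rd ρ * s) ^ 2 = P.Ld ρ * ρ * e ^ 2 := by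
      rw [mul_pow, hs2, he2]
      nth_rewrite 4 [hρ]
      field_simp
      ring
    have h5 : 2 * P.Rd ρ * s ≤ e := le_of_sq_le_sq (by
      rw [h4]; exact mul_le_of_le_one_left (sq_nonneg e) h3) he0.le
    have h6 : e / 2 ≤ 2 * P.Rd ρ * s := le_of_sq_le_sq (by
      rw [h4]
      have := mul_le_mul_of_nonneg_right h2 (sq_nonneg e)
      linarith [sq_nonneg e]) (by positivity)
    have h7 := mul_le_mul_of_nonneg_left h5 hε.le
    have h8 := mul_le_mul_of_nonneg_left h6 hε.le
    constructor
    · rw [le_div_iff₀ (by positivity)]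
      linarith
    · rw [div_le_iff₀ (by positivity)]
      linarith

theorem InnerOK.mono {P : QP n p} {δ δ' : ℝ} (h : δ ≤ δ') {u : E n} {mu : E p}
    (hu : P.InnerOK ρ δ u mu) : P.InnerOK ρ δ' u mu :=
  ⟨hu.1, hu.2.trans h⟩

theorem IsPrimalSol.mono {P : QP n p} {C C' δ δ' : ℝ} (h : C * δ ≤ C' * δ') {u : E n}
    (hu : P.IsPrimalSol C δ u) : P.IsPrimalSol C' δ' u :=
  ⟨hu.1, hu.2.1.trans h, hu.2.2.trans h⟩

/-- An approximate minimizer of the augmented Lagrangian at a multiplier of size `O(R_d)` is an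
approximate solution of the primal problem. -/
theorem isPrimalSol_of_innerOK (hε : 0 < ε) (hR : 1 < P.Rd ρ) (hρ : ρ = 8 * P.Rd ρ ^ 2 / ε)
    {nu : E p} (hnu : P.IsLagrangeMultiplier nu) {B : ℝ} (hB : 0 ≤ B) {mu : E p}
    (hmu : ‖mu‖ ≤ B * P.Rd ρ) {u : E n} (hu : u ∈ P.U) (hok : P.InnerOK ρ (ε / 2) u mu) :
    P.Rd ρ * ‖P.dualGrad ρ u mu‖ ≤ (1 + B) * ε ∧ P.IsPrimalSol (2 * (1 + B) ^ 2) ε u := by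
  have hR0 : 0 < P.Rd ρ := by linarith
  have hρ0 : 0 < ρ := by rw [hρ]; positivity
  obtain ⟨lam, hlam, hln⟩ := P.exists_dualOpt_norm_le hR0
  have hs := P.sOpt_mem hρ0 u mu
  have h1 := P.Fstar_le_of_mem_dualOpt hρ0 hnu hlam hu hs
  have h2 := P.dual_le_Fstar hρ0 hnu.1 mu
  have h3 := hok.2
  rw [P.lag_eq hρ0] at h3
  change _ ≤ P.F u + Inner.inner ℝ lam (P.dualGrad ρ u mu) at h1
  change P.F u + Inner.inner ℝ mu (P.dualGrad ρ u mu) + ρ / 2 * ‖P.dualGrad ρ u mu‖ ^ 2 - _ ≤ _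
    at h3
  have hdist : Metric.infDist (P.con u) P.K ≤ ‖P.dualGrad ρ u mu‖ := by
    have := Metric.infDist_le_dist_of_mem (x := P.con u) hs
    rwa [dist_eq_norm] at this
  set v := P.dualGrad ρ u mu
  set R := P.Rd ρ
  have hv : 0 ≤ ‖v‖ := norm_nonneg v
  have i1 : Inner.inner ℝ lam v ≤ 2 * (R * ‖v‖) := by
    have := mul_le_mul_of_nonneg_right hln hv
    linarith [real_inner_le_norm lam v]
  have i2 : -(B * (R * ‖v‖)) ≤ Inner.inner ℝ mu v := by
    have := mul_le_mul_of_nonneg_right hmu hv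
    linarith [neg_le_of_abs_le (abs_real_inner_le_norm mu v)]
  -- The chain `𝓛_ρ(u, μ) ≤ d_ρ(μ) + ε/2 ≤ F^* + ε/2 ≤ F(u) + ⟨λ, v⟩ + ε/2` loses `F(u)` on both
  -- sides; `ρ ε = 8 R²` then makes the inequality homogeneous in `R‖v‖` and `ε`.
  have hmain : 4 * (R * ‖v‖) ^ 2 ≤ ((2 + B) * (R * ‖v‖) + ε / 2) * ε := by
    have h4 : ρ / 2 * ‖v‖ ^ 2 ≤ (2 + B) * (R * ‖v‖) + ε / 2 := by linarith
    have h5 := mul_le_mul_of_nonneg_right h4 hε.le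
    have h6 : ρ * ε = 8 * R ^ 2 := (eq_div_iff hε.ne').1 hρ
    have h7 : ρ / 2 * ‖v‖ ^ 2 * ε = ρ * ε / 2 * ‖v‖ ^ 2 := by ring
    rw [h7, h6] at h5
    linarith
  have hRv : R * ‖v‖ ≤ (1 + B) * ε := by
    by_contra! hlt
    have : 0 ≤ B * ε := by positivity
    nlinarith
  refine ⟨hRv, hu, hdist.trans ?_, ?_⟩
  · have h8 : ‖v‖ ≤ R * ‖v‖ := le_mul_of_one_le_left hv hR.le
    have : (1 + B) * ε ≤ 2 * (1 + B) ^ 2 * ε :=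
      mul_le_mul_of_nonneg_right (by nlinarith) hε.le
    linarith
  · have h9 := mul_le_mul_of_nonneg_left hRv hB
    have : 0 ≤ B * ε := by positivity
    have : 0 ≤ B ^ 2 * ε := by positivity
    have : 0 ≤ ρ / 2 * ‖v‖ ^ 2 := by positivity
    rw [abs_le]
    constructor <;> linarith

theorem theta_one (c : Scheme) : c.theta 1 = 1 := by
  cases c
  · rfl
  · exact thetaFast_one

theorem average_one (c : Scheme) (ρ : ℝ) (m : ℕ) (u0 : E n) :
    P.average c ρ m u0 1 = (P.inner ρ m 0 u0).x := by
  simp [average, theta_one, dfom]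

theorem inner_ops (ρ : ℝ) (m : ℕ) (mu : E p) (x0 : E n) : (P.inner ρ m mu x0).ops = ⟨m, m, m⟩ :=
  fom_ops _ _ _ _ _ _

theorem dfom_one_ops (c : Scheme) (ρ : ℝ) (m : ℕ) (u0 : E n) :
    (P.dfom c ρ m u0 1).ops = ⟨m, m, m⟩ := by
  simp [dfom, inner_ops, Ops.add]

theorem lastOps_one (c : Scheme) (ρ : ℝ) (m : ℕ) (u0 : E n) :
    P.lastOps c ρ m u0 1 = ⟨m + m, m + m, m + m⟩ := by
  simp only [lastOps, last, dfom_one_ops, inner_ops, Ops.add]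

/-- The long step `1/(2 L_d) ≤ 9ρ/16` is offset by the small residual `ε / R_d`: the product is at
most `9/2 · R_d`. -/
theorem norm_dfom_one_lam_le (c : Scheme) (m : ℕ) (u0 : E n) (hε : 0 < ε) (hG : 0 < P.normG)
    (hR : 0 < P.Rd ρ) (hQ : lamMax P.Q ≤ P.normG ^ 2 * P.Rd ρ ^ 2 / ε)
    (hρ : ρ = 8 * P.Rd ρ ^ 2 / ε)
    (h : P.Rd ρ * ‖P.dualGrad ρ (P.inner ρ m 0 u0).x 0‖ ≤ ε) :
    ‖(P.dfom c ρ m u0 1).lam‖ ≤ 5 * P.Rd ρ := by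
  obtain ⟨h1, h2, -⟩ := P.Ld_mul_bounds hε hG hR hQ hρ
  simp only [dfom, zero_add]
  refine (P.norm_proj_Kd_le _).trans ?_
  rw [norm_smul, Real.norm_eq_abs, abs_of_pos (by positivity), div_mul_eq_mul_div,
    div_le_iff₀ (by positivity), one_mul]
  set v := P.dualGrad ρ (P.inner ρ m 0 u0).x 0
  have h3 : ρ * ε = 8 * P.Rd ρ ^ 2 := (eq_div_iff hε.ne').1 hρ
  have h4 : 8 / 9 * ε ≤ P.Ld ρ * (8 * P.Rd ρ ^ 2) := by
    rw [← h3]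
    have := mul_le_mul_of_nonneg_right h2 hε.le
    linarith
  have h5 : P.Rd ρ * ‖v‖ ≤ P.Rd ρ * (5 * P.Rd ρ * (2 * P.Ld ρ)) := by
    linarith
  exact le_of_mul_le_mul_left h5 hR

end QP

end DuQuad

/-! ### Assembly of the two statements. -/

open DuQuad
theorem mainTheorem5 :
    ∃ C : ℝ, 0 < C ∧
      ∀ (n p : ℕ) (P : QP n p) (ε ρ : ℝ),
        0 < ε → ε < 1 →
        (∃ lam : E p, P.IsLagrangeMultiplier lam) →
        1 < P.Rd ρ →
        lamMax P.Q ≤ P.normG ^ 2 * P.Rd ρ ^ 2 / ε →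
        ρ = 8 * P.Rd ρ ^ 2 / ε →
        ∀ (c : Scheme) (u0 : E n), u0 ∈ P.U →
          -- the average iterate, for which `k_out` inner problems are solved
          ((P.dfom c ρ (split (P.kTotal ρ ε) (P.kOut c ρ ε)) u0 (P.kOut c ρ ε)).ops.AtMost
              (max (P.kTotal ρ ε) (P.kOut c ρ ε)) ∧
            ∀ m : ℕ, split (P.kTotal ρ ε) (P.kOut c ρ ε) ≤ m →
              P.RunOK c ρ (P.epsIn c ρ ε) m u0 (P.kOut c ρ ε) ∧
              P.IsPrimalSol C ε (P.average c ρ m u0 (P.kOut c ρ ε))) ∧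
          -- the last iterate, for which `k_out + 1` inner problems are solved
          ((P.lastOps c ρ (split (P.kTotal ρ ε) (P.kOut c ρ ε + 1)) u0 (P.kOut c ρ ε)).AtMost
              (max (P.kTotal ρ ε) (P.kOut c ρ ε + 1)) ∧
            ∀ m : ℕ, split (P.kTotal ρ ε) (P.kOut c ρ ε + 1) ≤ m →
              P.RunOK c ρ (P.epsIn c ρ ε) m u0 (P.kOut c ρ ε) ∧
              P.InnerOK ρ (P.epsIn c ρ ε) (P.last c ρ m u0 (P.kOut c ρ ε)).x
                (P.dfom c ρ m u0 (P.kOut c ρ ε)).lam ∧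
              P.IsPrimalSol C (Real.sqrt ε) (P.last c ρ m u0 (P.kOut c ρ ε)).x) := by
  -- The value of `2 (1 + B)²` at `B = 5`, the bound for `λ¹`; the average iterate has `B = 0` and
  -- needs only `2`.
  refine ⟨72, by norm_num, ?_⟩
  intro n p P ε ρ hε hε1 ⟨nu, hnu⟩ hR hQ hρ c u0 hu0
  have hR0 : 0 < P.Rd ρ := by linarith
  have hρ0 : 0 < ρ := by rw [hρ]; positivity
  have hG := P.normG_pos hρ0 hnu.1 hR0
  obtain ⟨hin1, hin2⟩ := P.epsIn_bounds hε hG hR0 hQ hρ c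
  have hok : ∀ {m : ℕ}, 1 ≤ m → P.kTotal ρ ε < 2 * (m + 1) → ∀ (mu : E p) {x0 : E n},
      x0 ∈ P.U → P.InnerOK ρ (P.epsIn c ρ ε) (P.inner ρ m mu x0).x mu :=
    fun hm hk mu _ hx0 => (P.innerOK_inner hε hR0 hG hQ hρ hm hk mu hx0).mono hin1
  have hfirst : ∀ {m : ℕ}, 1 ≤ m → P.kTotal ρ ε < 2 * (m + 1) →
      P.RunOK c ρ (P.epsIn c ρ ε) m u0 1 ∧
      P.Rd ρ * ‖P.dualGrad ρ (P.inner ρ m 0 u0).x 0‖ ≤ (1 + 0) * ε ∧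
      P.IsPrimalSol (2 * (1 + 0) ^ 2) ε (P.inner ρ m 0 u0).x := by
    intro m hm hk
    have h := hok hm hk 0 hu0
    refine ⟨fun j hj => ?_, P.isPrimalSol_of_innerOK hε hR hρ hnu le_rfl (by simp)
      (P.inner_mem ρ m 0 hu0) (h.mono hin2)⟩
    obtain rfl : j = 0 := by omega
    exact h
  rw [P.kOut_eq_one hε hG hR0 hQ hρ c]
  refine ⟨⟨?_, fun m hm => ?_⟩, ?_, fun m hm => ?_⟩
  · rw [P.dfom_one_ops, split, Nat.div_one, max_comm]
    exact ⟨le_rfl, le_rfl, le_rfl⟩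
  · rw [split, Nat.div_one] at hm
    obtain ⟨h1, -, h3⟩ := hfirst (m := m) (by omega) (by omega)
    rw [P.average_one]
    exact ⟨h1, h3.mono (by linarith)⟩
  · rw [P.lastOps_one, split]
    have : max 1 (P.kTotal ρ ε / (1 + 1)) + max 1 (P.kTotal ρ ε / (1 + 1))
        ≤ max (P.kTotal ρ ε) (1 + 1) := by omega
    exact ⟨this, this, this⟩
  · rw [split] at hm
    have hm1 : 1 ≤ m := by omega
    -- Here the budget is halved with rounding down, which is why the inner lemma asks for `2 * (m +
    -- 1)` with strict inequality.
    have hk : P.kTotal ρ ε < 2 * (m + 1) := by omega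
    obtain ⟨h1, h2, -⟩ := hfirst hm1 hk
    have hmem : (P.dfom c ρ m u0 1).u ∈ P.U := P.inner_mem ρ m 0 hu0
    have h := hok hm1 hk (P.dfom c ρ m u0 1).lam hmem
    have hlam := P.norm_dfom_one_lam_le c m u0 hε hG hR0 hQ hρ (by linarith)
    have hsol := (P.isPrimalSol_of_innerOK hε hR hρ hnu (by norm_num) hlam
      (P.inner_mem ρ m _ hmem) (h.mono hin2)).2
    refine ⟨h1, h, hsol.mono ?_⟩
    -- The last iterate is in fact accurate to order `ε`; `ε < 1` weakens this to `√ε`.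
    have : ε ≤ Real.sqrt ε := Real.le_sqrt_of_sq_le (by nlinarith)
    linarith
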